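/- Let $G$ be a Lie group (finite-dimensional, or more generally a smooth Lie group without boundary modelled on a real normed space), and let $1\to U(1)\to\widehat G\xrightarrow{\ \rho\ }G\to 1$ be a central extension of Lie groups such that $\rho$ is a smooth, locally trivial principal $U(1)$-bundle. Let $NG(p)=G^p$, with face maps $\varepsilon_i:NG(p)\to NG(p-1)$, $\varepsilon_0(g_1,\dots,g_p)=(g_2,\dots,g_p)$, $\varepsilon_i(g_1,\dots,g_p)=(g_1,\dots,g_ig_{i+1},\dots,g_p)$ for $1\le i\le p-1$, $\varepsilon_p(g_1,\dots,g_p)=(g_1,\dots,g_{p-1})$. Let $\Omega^n(NG)=\bigoplus_{p+q=n}\Omega^q(NG(p))$ (real-valued smooth forms), with differential $D=d'+d''$, where $d'=\sum_{i=0}^{p+1}(-1)^i\varepsilon_i^*:\Omega^q(NG(p))\to\Omega^q(NG(p+1))$ and $d''=(-1)^pd$ on $\Omega^q(NG(p))$, and let $H^*(\Omega(NG))$ be its cohomology. Let $\delta\widehat G=\varepsilon_0^*\widehat G\otimes(\varepsilon_1^*\widehat G)^{\otimes -1}\otimes\varepsilon_2^*\widehat G$, a $U(1)$-bundle over $NG(2)=G\times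 G$. For a connection form $\theta\in\Omega^1(\widehat G;i\mathbb R)$ on $\rho$, let $\delta\theta$ be the induced connection on $\delta\widehat G$ (its pull-back to $\varepsilon_0^*\widehat G\times\varepsilon_1^*\widehat G\times\varepsilon_2^*\widehat G$ is $\mathrm{pr}_0^*\theta-\mathrm{pr}_1^*\theta+\mathrm{pr}_2^*\theta$), and let $c_1(\theta)\in\Omega^2(G)$ be the form with $\rho^*c_1(\theta)=\left(\frac{-1}{2\pi i}\right)d\theta$. For a smooth global section $\hat s$ of $\delta\widehat G$ put $$z(\theta,\hat s)=c_1(\theta)-\left(\tfrac{-1}{2\pi i}\right)\hat s^*(\delta\theta)\in\Omega^2(NG(1))\oplus\Omega^1(NG(2))\subset\Omega^3(NG).$$ Then: 1. For every connection $\theta$ the form $c_1(\theta)$ exists and is unique, and for every smooth global section $\hat s$ the form $\hat s^*(\delta\theta)$ is well defined. 2. The canonical section $\hat s_0(g_1,g_2)=\hat g_2\otimes(\hat g_1\hat g_2)^{\otimes-1}\otimes\hat g_1$ (for any $\hat g_1,\hat g_2$ with $\rho(\hat g_j)=g_j$) is smooth, and $z(\theta,\hat s_0)$ is a cocycle for every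 connection $\theta$. 3. Let $\hat s$ be any smooth global section of $\delta\widehat G$ and let $\theta_0,\theta_1$ be connections on $\widehat G$. Then $z(\theta_1,\hat s)-z(\theta_0,\hat s)$ is a coboundary in $\Omega^*(NG)$; and if $z(\theta_0,\hat s)$ is a cocycle (for instance if $\hat s=\hat s_0$), then so is $z(\theta_1,\hat s)$, and $$[z(\theta_0,\hat s)]=[z(\theta_1,\hat s)]\in H^3(\Omega(NG)).$$ That is, the class of $c_1(\theta)-\left(\frac{-1}{2\pi i}\right)\hat s^*(\delta\theta)$ does not depend on the choice of the connection $\theta$. -/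

import Mathlib

open scoped Manifold ContDiff Topology

noncomputable section

namespace SimplicialDeRham

section Linear
variable {E E' F : Type*} [NormedAddCommGroup E] [NormedSpace ℝ E] [NormedAddCommGroup E']
  [NormedSpace ℝ E'] [NormedAddCommGroup F] [NormedSpace ℝ F]

/-- normalised alternatization, a continuous left inverse of the inclusion of alternating maps
into multilinear maps. -/
def altProj (q : ℕ) : ContinuousMultilinearMap ℝ (fun _ : Fin q => E) F →L[ℝ] E [⋀^Fin q]→L[ℝ] F :=
  LinearMap.mkContinuous
    { toFun := fun f => ((q.factorial : ℝ)⁻¹) • ContinuousMultilinearMap.alternatization f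
      map_add' := fun f g => by simp
      map_smul' := fun c f => by
        ext v
        simp only [ContinuousAlternatingMap.smul_apply, RingHom.id_apply,
          ContinuousMultilinearMap.alternatization_apply_apply, _root_.smul_apply]
        simp only [Finset.smul_sum]
        refine Finset.sum_congr rfl fun σ _ => ?_
        rw [smul_comm (Equiv.Perm.sign σ) c, smul_comm _ c] }
    1 (fun f => by
      refine ContinuousAlternatingMap.opNorm_le_bound _ (by positivity) fun v => ?_
      simp only [LinearMap.coe_mk, AddHom.coe_mk, ContinuousAlternatingMap.smul_apply,
          ContinuousMultilinearMap.alternatization_apply_apply]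
      rw [norm_smul]
      have h : ‖∑ σ : Equiv.Perm (Fin q), Equiv.Perm.sign σ • f (v ∘ σ)‖
          ≤ ∑ σ : Equiv.Perm (Fin q), ‖f‖ * ∏ i, ‖v i‖ := by
        refine norm_sum_le_of_le _ fun σ _ => ?_
        have h1 : ‖Equiv.Perm.sign σ • f (v ∘ σ)‖ = ‖f (v ∘ σ)‖ := by
          rcases Int.units_eq_one_or (Equiv.Perm.sign σ) with h | h <;> simp [h]
        rw [h1]
        refine (f.le_opNorm _).trans_eq ?_
        congr 1
        exact Equiv.prod_comp σ (fun i => ‖v i‖)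
      rw [Finset.sum_const, Finset.card_univ, Fintype.card_perm, Fintype.card_fin, nsmul_eq_mul] at h
      have hq : (0 : ℝ) < q.factorial := by exact_mod_cast q.factorial_pos
      rw [norm_inv, Real.norm_natCast, one_mul]
      calc _ ≤ (q.factorial : ℝ)⁻¹ * ((q.factorial : ℝ) * (‖f‖ * ∏ i, ‖v i‖)) := by gcongr
        _ = _ := by field_simp)

theorem altProj_coe {q : ℕ} (f : E [⋀^Fin q]→L[ℝ] F) :
    altProj q f.toContinuousMultilinearMap = f := by
  ext v
  have hq : (q.factorial : ℝ) ≠ 0 := by exact_mod_cast q.factorial_ne_zero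
  have : ∀ σ : Equiv.Perm (Fin q), Equiv.Perm.sign σ • f (v ∘ σ) = f v := by
    intro σ
    rw [show f (v ∘ σ) = Equiv.Perm.sign σ • f v from f.toAlternatingMap.map_perm v σ, smul_smul]
    simp
  change (q.factorial : ℝ)⁻¹ •
    (ContinuousMultilinearMap.alternatization f.toContinuousMultilinearMap) v = f v
  rw [ContinuousMultilinearMap.alternatization_apply_apply]
  change (q.factorial : ℝ)⁻¹ • ∑ σ : Equiv.Perm (Fin q), Equiv.Perm.sign σ • f (v ∘ σ) = f v
  simp only [this]
  rw [Finset.sum_const, Finset.card_univ, Fintype.card_perm, Fintype.card_fin, ← Nat.cast_smul_eq_nsmul ℝ,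
    smul_smul, inv_mul_cancel₀ hq, one_smul]

theorem contDiff_compContinuousLinearMap {q : ℕ} :
    ContDiff ℝ ∞ (fun p : (E' [⋀^Fin q]→L[ℝ] F) × (E →L[ℝ] E') =>
      p.1.compContinuousLinearMap p.2) := by
  have h : (fun p : (E' [⋀^Fin q]→L[ℝ] F) × (E →L[ℝ] E') =>
      p.1.compContinuousLinearMap p.2) = fun p => altProj q
        (ContinuousMultilinearMap.compContinuousLinearMapContinuousMultilinear ℝ
          (fun _ : Fin q => E) (fun _ => E') F (fun _ => p.2)
          (ContinuousAlternatingMap.toContinuousMultilinearMapCLM ℝ p.1)) := by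
    funext p
    exact (altProj_coe _).symm
  rw [h]
  refine (altProj (E := E) (F := F) q).contDiff.comp ?_
  refine ContDiff.clm_apply ?_ ?_
  · refine (ContinuousMultilinearMap.contDiff _).comp ?_
    exact contDiff_pi.2 fun _ => contDiff_snd
  · exact (ContinuousLinearMap.contDiff _).comp contDiff_fst

theorem contDiffAt_compContinuousLinearMap {q : ℕ} {V : Type*} [NormedAddCommGroup V]
    [NormedSpace ℝ V] {f : V → E' [⋀^Fin q]→L[ℝ] F} {g : V → E →L[ℝ] E'} {z : V}
    (hf : ContDiffAt ℝ ∞ f z) (hg : ContDiffAt ℝ ∞ g z) :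
    ContDiffAt ℝ ∞ (fun w => (f w).compContinuousLinearMap (g w)) z :=
  ContDiffAt.comp (g := fun p : (E' [⋀^Fin q]→L[ℝ] F) × (E →L[ℝ] E') =>
      p.1.compContinuousLinearMap p.2) (f := fun w => (f w, g w)) z
    contDiff_compContinuousLinearMap.contDiffAt (hf.prodMk hg)

end Linear

section Pi
variable {ι : Type*} [Fintype ι] {E H : ι → Type*} [∀ i, NormedAddCommGroup (E i)]
  [∀ i, NormedSpace ℝ (E i)] [∀ i, TopologicalSpace (H i)] (I : ∀ i, ModelWithCorners ℝ (E i) (H i))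
  {M : ι → Type*} [∀ i, TopologicalSpace (M i)] [∀ i, ChartedSpace (H i) (M i)]

instance pi_boundaryless [∀ i, (I i).Boundaryless] : (ModelWithCorners.pi I).Boundaryless where
  range_eq_univ := by
    change Set.range (fun (x : ∀ i, H i) i => I i (x i)) = Set.univ
    refine Set.range_eq_univ.2 fun y => ?_
    have : ∀ i, ∃ x, I i x = y i := fun i => by
      have := (I i).range_eq_univ
      exact Set.range_eq_univ.1 this (y i)
    choose x hx using this
    exact ⟨x, funext hx⟩

instance pi_isManifold [∀ i, IsManifold (I i) ∞ (M i)] :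
    IsManifold (ModelWithCorners.pi I) ∞ (∀ i, M i) := by
  refine isManifold_of_contDiffOn _ _ _ ?_
  rintro _ _ ⟨e, he, rfl⟩ ⟨e', he', rfl⟩
  refine contDiffOn_pi.2 fun i => ?_
  have h := ((contDiffGroupoid ∞ (I i)).compatible (he i trivial) (he' i trivial))
  rw [contDiffGroupoid, mem_groupoid_of_pregroupoid] at h
  have h1 : ContDiffOn ℝ ∞ (I i ∘ ((e i).symm ≫ₕ e' i) ∘ (I i).symm)
    ((I i).symm ⁻¹' ((e i).symm ≫ₕ e' i).source ∩ Set.range (I i)) := h.1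
  refine h1.comp (t := _) (f := fun x : ∀ i, E i => x i) (ContinuousLinearMap.proj (R := ℝ) (φ := E) i).contDiff.contDiffOn ?_
  rintro x ⟨hx, ⟨y, rfl⟩⟩
  exact ⟨⟨hx.1 i trivial, hx.2 i trivial⟩, ⟨y i, rfl⟩⟩

theorem contMDiff_pi_mk {E₀ H₀ M₀ : Type*} [NormedAddCommGroup E₀] [NormedSpace ℝ E₀]
    [TopologicalSpace H₀] {I₀ : ModelWithCorners ℝ E₀ H₀} [TopologicalSpace M₀] [ChartedSpace H₀ M₀]
    {f : M₀ → ∀ i, M i} (h : ∀ i, ContMDiff I₀ (I i) ∞ fun x => f x i) :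
    ContMDiff I₀ (ModelWithCorners.pi I) ∞ f := by
  intro x
  rw [contMDiffAt_iff]
  refine ⟨(continuous_pi fun i => (h i).continuous).continuousAt, ?_⟩
  refine contDiffWithinAt_pi.2 fun i => ?_
  exact ((contMDiffAt_iff ..).1 (h i x)).2

theorem contMDiff_eval (i : ι) :
    ContMDiff (ModelWithCorners.pi I) (I i) ∞ fun x : ∀ i, M i => x i := by
  intro x
  rw [contMDiffAt_iff]
  refine ⟨(continuous_apply i).continuousAt, ?_⟩
  have : ContDiffWithinAt ℝ ∞ (fun y : ∀ i, E i => y i) (Set.range (ModelWithCorners.pi I))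
     (extChartAt (ModelWithCorners.pi I) x x) := (ContinuousLinearMap.proj (R := ℝ) (φ := E) i).contDiff.contDiffWithinAt
  refine this.congr_of_eventuallyEq ?_ ?_
  · filter_upwards [extChartAt_target_mem_nhdsWithin (I := ModelWithCorners.pi I) x] with y hy
    have h1 : y i ∈ (extChartAt (I i) (x i)).target := by
      simp only [extChartAt_target] at hy ⊢
      refine ⟨hy.1 i trivial, ?_⟩
      obtain ⟨z, rfl⟩ := hy.2
      exact ⟨z i, rfl⟩
    exact (extChartAt (I i) (x i)).right_inv h1
  · exact (extChartAt (I i) (x i)).right_inv ((extChartAt (I i) (x i)).map_source (mem_extChartAt_source _))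

end Pi

section Forms
variable {E H : Type*} [NormedAddCommGroup E] [NormedSpace ℝ E] [TopologicalSpace H]
  {I : ModelWithCorners ℝ E H} {M : Type*} [TopologicalSpace M] [ChartedSpace H M]
variable {E' H' N : Type*} [NormedAddCommGroup E'] [NormedSpace ℝ E'] [TopologicalSpace H']
  {I' : ModelWithCorners ℝ E' H'} [TopologicalSpace N] [ChartedSpace H' N]
variable {F F' : Type*} [NormedAddCommGroup F] [NormedSpace ℝ F]
  [NormedAddCommGroup F'] [NormedSpace ℝ F']

variable (I M F) in
/-- A field of `F`-valued alternating `q`-linear forms on the tangent spaces of `M`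
(no smoothness is required). -/
abbrev FormField (q : ℕ) := ∀ x : M, TangentSpace I x [⋀^Fin q]→L[ℝ] F

/-- The expression of a field of forms in the preferred chart around `x₀`: its pull-back under the
inverse of the chart, a field of forms on the model vector space. -/
def FormField.inChart {q : ℕ} (α : FormField I M F q) (x₀ : M) (y : E) : E [⋀^Fin q]→L[ℝ] F :=
  (α ((extChartAt I x₀).symm y)).compContinuousLinearMap
    (mfderiv 𝓘(ℝ, E) I (extChartAt I x₀).symm y)

/-- The pull-back of a field of forms along a map `f`. -/
def FormField.pullback {q : ℕ} (f : M → N) (α : FormField I' N F q) : FormField I M F q :=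
  fun x => (α (f x)).compContinuousLinearMap (mfderiv I I' f x)

/-- The exterior derivative of a field of forms, computed in the preferred chart around each point
(on a manifold without boundary). -/
def FormField.extDeriv {q : ℕ} (α : FormField I M F q) : FormField I M F (q + 1) :=
  fun x => (_root_.extDeriv (α.inChart x) (extChartAt I x x)).compContinuousLinearMap
    (mfderiv I 𝓘(ℝ, E) (extChartAt I x) x)

/-- Smoothness of a field of forms: its expression in the chart around each point is smooth there.-/
def FormField.IsSmooth {q : ℕ} (α : FormField I M F q) : Prop :=
  ∀ x : M, ContDiffAt ℝ ∞ (α.inChart x) (extChartAt I x x)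

theorem FormField.inChart_add {q : ℕ} (α β : FormField I M F q) (x₀ : M) :
    FormField.inChart (α + β) x₀ = α.inChart x₀ + β.inChart x₀ := rfl

theorem FormField.inChart_smul {q : ℕ} (c : ℝ) (α : FormField I M F q) (x₀ : M) :
    FormField.inChart (c • α) x₀ = c • α.inChart x₀ := rfl

variable (I M F) in
/-- The space `Ω^q(M; F)` of smooth differential `q`-forms on `M` with values in `F`. -/
def DForm (q : ℕ) : Submodule ℝ (FormField I M F q) where
  carrier := {α | α.IsSmooth}
  zero_mem' := fun x => by
    change ContDiffAt ℝ ∞ (fun _ => 0) _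
    exact contDiffAt_const
  add_mem' := fun h₁ h₂ x => (h₁ x).add (h₂ x)
  smul_mem' := fun c _ h x => (h x).const_smul c


/-- The value of a form at `x`, on the model vector space underlying the tangent space. -/
def FormField.toModel {q : ℕ} (α : FormField I M F q) (x : M) : E [⋀^Fin q]→L[ℝ] F := α x

theorem FormField.comp_congr {q : ℕ} (α : FormField I M F q) {x x' : M} (h : x = x')
    {A A' : E' →L[ℝ] E} (hA : A = A') :
    (α.toModel x).compContinuousLinearMap A = (α.toModel x').compContinuousLinearMap A' := by
  subst h hA; rfl

/-- The expression of a pull-back in charts. -/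
theorem FormField.inChart_pullback [IsManifold I ∞ M] [IsManifold I' ∞ N]
    [I.Boundaryless] [I'.Boundaryless] {q : ℕ} {f : M → N}
    (α : FormField I' N F q) (x₀ : M) (y₀ : N) {x : M} (hx : x ∈ (extChartAt I x₀).source)
    (hy : f x ∈ (extChartAt I' y₀).source) (hf : MDifferentiableAt I I' f x) :
    (FormField.pullback (I := I) f α).inChart x₀ (extChartAt I x₀ x) =
      (α.inChart y₀ (extChartAt I' y₀ (f x))).compContinuousLinearMap
        (fderiv ℝ (extChartAt I' y₀ ∘ f ∘ (extChartAt I x₀).symm) (extChartAt I x₀ x)) := by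
  set z := extChartAt I x₀ x with hz
  have hzt : z ∈ (extChartAt I x₀).target := (extChartAt I x₀).map_source hx
  have hxz : (extChartAt I x₀).symm z = x := (extChartAt I x₀).left_inv hx
  have hs : MDifferentiableAt 𝓘(ℝ, E) I (extChartAt I x₀).symm z := by
    have := mdifferentiableWithinAt_extChartAt_symm (I := I) hzt
    rwa [I.range_eq_univ, mdifferentiableWithinAt_univ] at this
  have hf' : MDifferentiableAt I I' f ((extChartAt I x₀).symm z) := by rw [hxz]; exact hf
  have hs' : MDifferentiableAt 𝓘(ℝ, E') I' (extChartAt I' y₀).symm (extChartAt I' y₀ (f x)) := by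
    have := mdifferentiableWithinAt_extChartAt_symm (I := I') ((extChartAt I' y₀).map_source hy)
    rwa [I'.range_eq_univ, mdifferentiableWithinAt_univ] at this
  have hc : MDifferentiableAt I' 𝓘(ℝ, E') (extChartAt I' y₀) (f ((extChartAt I x₀).symm z)) := by
    rw [hxz]
    exact mdifferentiableAt_extChartAt (by simpa using hy)
  have hF : MDifferentiableAt 𝓘(ℝ, E) 𝓘(ℝ, E')
      (extChartAt I' y₀ ∘ f ∘ (extChartAt I x₀).symm) z :=
    hc.comp z (hf'.comp z hs)
  have hFz : (extChartAt I' y₀ ∘ f ∘ (extChartAt I x₀).symm) z = extChartAt I' y₀ (f x) := by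
    simp only [Function.comp_apply, hxz]
  have hs'' : MDifferentiableAt 𝓘(ℝ, E') I' (extChartAt I' y₀).symm
      ((extChartAt I' y₀ ∘ f ∘ (extChartAt I x₀).symm) z) := by rw [hFz]; exact hs'
  have key : (mfderiv I I' f ((extChartAt I x₀).symm z)).comp
      (mfderiv 𝓘(ℝ, E) I (extChartAt I x₀).symm z) =
      (mfderiv 𝓘(ℝ, E') I' (extChartAt I' y₀).symm
        ((extChartAt I' y₀ ∘ f ∘ (extChartAt I x₀).symm) z)).comp
        (mfderiv 𝓘(ℝ, E) 𝓘(ℝ, E') (extChartAt I' y₀ ∘ f ∘ (extChartAt I x₀).symm) z) := by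
    rw [← mfderiv_comp z hf' hs]
    refine Eq.trans ?_ (mfderiv_comp z hs'' hF)
    refine Filter.EventuallyEq.mfderiv_eq ?_
    have hcont : ContinuousAt (f ∘ (extChartAt I x₀).symm) z := (hf'.comp z hs).continuousAt
    have hmem : (extChartAt I' y₀).source ∈ 𝓝 ((f ∘ (extChartAt I x₀).symm) z) := by
      refine (isOpen_extChartAt_source y₀).mem_nhds ?_
      simpa only [Function.comp_apply, hxz] using hy
    filter_upwards [hcont.preimage_mem_nhds hmem] with w hw
    exact ((extChartAt I' y₀).left_inv hw).symm
  rw [mfderiv_eq_fderiv] at key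
  have h1 : f ((extChartAt I x₀).symm z) = (extChartAt I' y₀).symm (extChartAt I' y₀ (f x)) := by
    rw [hxz, (extChartAt I' y₀).left_inv hy]
  rw [hFz] at key
  exact FormField.comp_congr (E' := E) α h1 key

theorem FormField.pullback_id {q : ℕ} (α : FormField I M F q) :
    FormField.pullback (fun x : M => x) α = α := by
  funext x
  ext v
  change α x (fun i => mfderiv I I (@id M) x (v i)) = α x v
  rw [mfderiv_id]
  rfl

/-- The expressions of a pull-back in charts around `x₀` and `y₀`, near a given point. -/
theorem FormField.inChart_pullback_eventuallyEq [IsManifold I ∞ M] [IsManifold I' ∞ N]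
    [I.Boundaryless] [I'.Boundaryless] {q : ℕ} {f : M → N}
    (α : FormField I' N F q) (x₀ : M) (y₀ : N) {x : M} (hx : x ∈ (extChartAt I x₀).source)
    (hy : f x ∈ (extChartAt I' y₀).source) (hf : ContMDiffAt I I' ∞ f x) :
    (FormField.pullback (I := I) f α).inChart x₀ =ᶠ[𝓝 (extChartAt I x₀ x)] fun z =>
      (α.inChart y₀ ((extChartAt I' y₀ ∘ f ∘ (extChartAt I x₀).symm) z)).compContinuousLinearMap
        (fderiv ℝ (extChartAt I' y₀ ∘ f ∘ (extChartAt I x₀).symm) z) := by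
  have h1 : ∀ᶠ w in 𝓝 x, ContMDiffAt I I' 1 f w := by
    have : ContMDiffAt I I' 1 f x := hf.of_le (by simp)
    exact (contMDiffAt_iff_contMDiffAt_nhds (by simp)).1 this
  have h2 : ∀ᶠ w in 𝓝 x, f w ∈ (extChartAt I' y₀).source :=
    hf.continuousAt.preimage_mem_nhds ((isOpen_extChartAt_source y₀).mem_nhds hy)
  have hxz : (extChartAt I x₀).symm (extChartAt I x₀ x) = x := (extChartAt I x₀).left_inv hx
  have hc : Filter.Tendsto (extChartAt I x₀).symm (𝓝 (extChartAt I x₀ x)) (𝓝 x) := by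
    have := continuousAt_extChartAt_symm' (I := I) hx
    rwa [ContinuousAt, hxz] at this
  have h3 : (extChartAt I x₀).target ∈ 𝓝 (extChartAt I x₀ x) :=
    (isOpen_extChartAt_target x₀).mem_nhds ((extChartAt I x₀).map_source hx)
  filter_upwards [hc.eventually h1, hc.eventually h2, h3] with z hz1 hz2 hz3
  have := FormField.inChart_pullback (I := I) α x₀ y₀ ((extChartAt I x₀).map_target hz3) hz2
    (hz1.mdifferentiableAt one_ne_zero)
  rw [(extChartAt I x₀).right_inv hz3] at this
  exact this

theorem contDiffAt_inCharts [IsManifold I ∞ M] [IsManifold I' ∞ N] [I.Boundaryless]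
    {f : M → N} (x₀ : M) (y₀ : N) {x : M} (hx : x ∈ (extChartAt I x₀).source)
    (hy : f x ∈ (extChartAt I' y₀).source) (hf : ContMDiffAt I I' ∞ f x) :
    ContDiffAt ℝ ∞ (extChartAt I' y₀ ∘ f ∘ (extChartAt I x₀).symm) (extChartAt I x₀ x) := by
  have := (contMDiffAt_iff_of_mem_source (by simpa using hx) (by simpa using hy)).1 hf
  have := this.2
  rwa [I.range_eq_univ, contDiffWithinAt_univ] at this

/-- Smoothness can be tested in any chart of the distinguished family. -/
theorem FormField.IsSmooth.contDiffAt [IsManifold I ∞ M] [I.Boundaryless] {q : ℕ}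
    {α : FormField I M F q} (h : α.IsSmooth) (x₀ : M) {x : M}
    (hx : x ∈ (extChartAt I x₀).source) :
    ContDiffAt ℝ ∞ (α.inChart x₀) (extChartAt I x₀ x) := by
  have h1 := FormField.inChart_pullback_eventuallyEq (I := I) (I' := I) α x₀ x hx
    (f := fun x => x) (mem_extChartAt_source x) contMDiffAt_id
  rw [FormField.pullback_id] at h1
  refine ContDiffAt.congr_of_eventuallyEq ?_ h1
  have hF := contDiffAt_inCharts (I := I) (I' := I) x₀ x hx
    (f := fun x => x) (mem_extChartAt_source x) contMDiffAt_id
  have hFx : (extChartAt I x ∘ (fun x => x) ∘ (extChartAt I x₀).symm) (extChartAt I x₀ x)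
      = extChartAt I x x := by
    simp only [Function.comp_apply, (extChartAt I x₀).left_inv hx]
  refine contDiffAt_compContinuousLinearMap ?_ ?_
  · refine ContDiffAt.comp (g := α.inChart x) _ ?_ hF
    rw [hFx]
    exact h x
  · exact hF.fderiv_right (by simp)

/-- The pull-back of a smooth form along a map that is smooth near a point is smooth there. -/
theorem FormField.contDiffAt_pullback [IsManifold I ∞ M] [IsManifold I' ∞ N]
    [I.Boundaryless] [I'.Boundaryless] {q : ℕ} {f : M → N}
    {α : FormField I' N F q} (h : α.IsSmooth) {x : M} (hf : ContMDiffAt I I' ∞ f x) :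
    ContDiffAt ℝ ∞ ((FormField.pullback (I := I) f α).inChart x) (extChartAt I x x) := by
  refine ContDiffAt.congr_of_eventuallyEq ?_ (FormField.inChart_pullback_eventuallyEq (I := I) α x
    (f x) (mem_extChartAt_source x) (mem_extChartAt_source (f x)) hf)
  have hF := contDiffAt_inCharts (I := I) (I' := I') x (f x) (mem_extChartAt_source x)
    (mem_extChartAt_source (f x)) hf
  have hFx : (extChartAt I' (f x) ∘ f ∘ (extChartAt I x).symm) (extChartAt I x x)
      = extChartAt I' (f x) (f x) := by
    simp only [Function.comp_apply, (extChartAt I x).left_inv (mem_extChartAt_source x)]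
  refine contDiffAt_compContinuousLinearMap ?_ ?_
  · refine ContDiffAt.comp (g := α.inChart (f x)) _ ?_ hF
    rw [hFx]
    exact h (f x)
  · exact hF.fderiv_right (by simp)

/-- The exterior derivative may be computed in any chart of the distinguished family. -/
theorem FormField.inChart_extDeriv [IsManifold I ∞ M] [I.Boundaryless] {q : ℕ}
    {α : FormField I M F q} (h : α.IsSmooth) (x₀ : M) {x : M}
    (hx : x ∈ (extChartAt I x₀).source) :
    (FormField.extDeriv α).inChart x₀ (extChartAt I x₀ x) =
      _root_.extDeriv (α.inChart x₀) (extChartAt I x₀ x) := by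
  have h1 := FormField.inChart_pullback_eventuallyEq (I := I) (I' := I) α x₀ x hx
    (f := fun x => x) (mem_extChartAt_source x) contMDiffAt_id
  rw [FormField.pullback_id] at h1
  have hF := contDiffAt_inCharts (I := I) (I' := I) x₀ x hx
    (f := fun x => x) (mem_extChartAt_source x) contMDiffAt_id
  have hxz : (extChartAt I x₀).symm (extChartAt I x₀ x) = x := (extChartAt I x₀).left_inv hx
  have hFx : (extChartAt I x ∘ (fun x => x) ∘ (extChartAt I x₀).symm) (extChartAt I x₀ x)
      = extChartAt I x x := by
    simp only [Function.comp_apply, hxz]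
  rw [h1.extDeriv_eq, extDeriv_pullback (r := ∞) ?_ hF (by simpa using ENat.LEInfty.out)]
  · have h2 := FormField.inChart_pullback (I := I) (I' := I) (FormField.extDeriv α) x₀ x hx
      (f := fun x => x) (mem_extChartAt_source x) mdifferentiableAt_id
    rw [FormField.pullback_id] at h2
    rw [h2, hFx]
    congr 1
    have h3 : (mfderiv I 𝓘(ℝ, E) (extChartAt I x) x).comp
      (mfderiv 𝓘(ℝ, E) I (extChartAt I x).symm (extChartAt I x x)) = ContinuousLinearMap.id ℝ E := by
      have := mfderiv_extChartAt_comp_mfderivWithin_extChartAt_symm' (I := I)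
        (mem_extChartAt_source (I := I) x)
      rwa [I.range_eq_univ, mfderivWithin_univ] at this
    refine (FormField.comp_congr (FormField.extDeriv α)
      ((extChartAt I x).left_inv (mem_extChartAt_source x)) rfl).trans ?_
    ext v
    change (_root_.extDeriv (α.inChart x) (extChartAt I x x)) (fun i =>
      (mfderiv I 𝓘(ℝ, E) (extChartAt I x) x).comp
      (mfderiv 𝓘(ℝ, E) I (extChartAt I x).symm (extChartAt I x x)) (v i)) = _
    rw [h3]
    rfl
  · rw [hFx]
    exact (h x).differentiableAt (by simp)

theorem FormField.IsSmooth.extDeriv [IsManifold I ∞ M] [I.Boundaryless] {q : ℕ}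
    {α : FormField I M F q} (h : α.IsSmooth) : (FormField.extDeriv α).IsSmooth := by
  intro x
  have h1 : (FormField.extDeriv α).inChart x =ᶠ[𝓝 (extChartAt I x x)]
      _root_.extDeriv (α.inChart x) := by
    filter_upwards [(isOpen_extChartAt_target x).mem_nhds
      ((extChartAt I x).map_source (mem_extChartAt_source x))] with z hz
    have := FormField.inChart_extDeriv h x ((extChartAt I x).map_target hz)
    rwa [(extChartAt I x).right_inv hz] at this
  refine ContDiffAt.congr_of_eventuallyEq ?_ h1
  have h2 : ContDiffAt ℝ ∞ (fderiv ℝ (α.inChart x)) (extChartAt I x x) :=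
    (h x).fderiv_right (by simp)
  exact (ContinuousAlternatingMap.alternatizeUncurryFinCLM ℝ E F).contDiff.contDiffAt.comp _ h2

namespace DForm

/-- The pull-back `f^* : Ω^q(N; F) → Ω^q(M; F)` along a smooth map. -/
def pullback [IsManifold I ∞ M] [IsManifold I' ∞ N] [I.Boundaryless] [I'.Boundaryless] {q : ℕ}
    (f : M → N) (hf : ContMDiff I I' ∞ f) : DForm I' N F q →ₗ[ℝ] DForm I M F q where
  toFun α := ⟨FormField.pullback f α.1, fun _ => FormField.contDiffAt_pullback α.2 hf.contMDiffAt⟩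
  map_add' _ _ := rfl
  map_smul' _ _ := rfl

/-- The exterior derivative `d : Ω^q(M; F) → Ω^{q+1}(M; F)`. -/
def d [IsManifold I ∞ M] [I.Boundaryless] {q : ℕ} : DForm I M F q →ₗ[ℝ] DForm I M F (q + 1) where
  toFun α := ⟨FormField.extDeriv α.1, α.2.extDeriv⟩
  map_add' α β := by
    ext x v
    have h := extDeriv_add (((α.2 x).differentiableAt (by simp)))
      (((β.2 x).differentiableAt (by simp)))
    change (_root_.extDeriv (α.1.inChart x + β.1.inChart x) (extChartAt I x x)) _ = _
    rw [h]
    rfl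
  map_smul' c α := by
    ext x v
    have h := extDeriv_smul (x := extChartAt I x x) c (α.1.inChart x)
    change (_root_.extDeriv (c • α.1.inChart x) (extChartAt I x x)) _ = _
    rw [h]
    rfl

/-- Applying a linear map to the values of a form. -/
def mapCoeff {q : ℕ} (L : F →L[ℝ] F') : DForm I M F q →ₗ[ℝ] DForm I M F' q where
  toFun α := ⟨fun x => L.compContinuousAlternatingMap (α.1 x), fun x =>
    (ContinuousLinearMap.compContinuousAlternatingMapCLM ℝ E F F' (Fin q) L).contDiff.contDiffAt.comp _ (α.2 x)⟩
  map_add' _ _ := by ext; simp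
  map_smul' _ _ := by ext; simp

end DForm

end Forms

section Nerve
variable {E H : Type*} [NormedAddCommGroup E] [NormedSpace ℝ E] [TopologicalSpace H]
  (I : ModelWithCorners ℝ E H) (G : Type*) [TopologicalSpace G] [ChartedSpace H G]

/-- `NG(p) = G × ⋯ × G` (`p` factors). -/
abbrev Nerve (p : ℕ) := Fin p → G

/-- The model with corners of the product manifold `NG(p)`. -/
abbrev nerveModel (p : ℕ) := ModelWithCorners.pi (fun _ : Fin p => I)

variable {G}

/-- The face operators `ε_i : NG(p+1) → NG(p)`, `i = 0, …, p+1`: they drop the first entry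
(`i = 0`), multiply the `i`-th and `(i+1)`-st entries (`1 ≤ i ≤ p`; entries are counted from `1`
here and from `0` in the code), or drop the last entry (`i = p+1`). -/
def face [Mul G] {p : ℕ} (i : Fin (p + 2)) (g : Nerve G (p + 1)) : Nerve G p := fun j =>
  if j.val + 1 < i.val then g j.castSucc
  else if j.val + 1 = i.val then g j.castSucc * g j.succ
  else g j.succ

theorem contMDiff_face [Group G] [LieGroup I ∞ G] {p : ℕ} (i : Fin (p + 2)) :
    ContMDiff (nerveModel I (p + 1)) (nerveModel I p) ∞ (face (G := G) i) := by
  refine contMDiff_pi_mk _ fun j => ?_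
  have h : ∀ k : Fin (p + 1), ContMDiff (nerveModel I (p + 1)) I ∞
      fun g : Nerve G (p + 1) => g k := fun k => contMDiff_eval (fun _ : Fin (p + 1) => I) k
  unfold face
  split_ifs
  · exact h _
  · exact (h _).mul (h _)
  · exact h _

variable [Group G] [LieGroup I ∞ G] [I.Boundaryless]

variable (G) in
/-- `Ω^{p,q}(NG) = Ω^q(NG(p))`, with real coefficients. -/
abbrev NerveForm (p q : ℕ) := DForm (nerveModel I p) (Nerve G p) ℝ q

/-- The horizontal differential `d' = ∑_{i=0}^{p+1} (-1)^i ε_i^* : Ω^{p,q} → Ω^{p+1,q}`. -/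
def dHor {p q : ℕ} : NerveForm I G p q →ₗ[ℝ] NerveForm I G (p + 1) q :=
  ∑ i : Fin (p + 2), (-1 : ℝ) ^ i.val • DForm.pullback (face i) (contMDiff_face I i)

/-- The vertical differential `d'' = (-1)^p d : Ω^{p,q} → Ω^{p,q+1}`. -/
def dVer {p q : ℕ} : NerveForm I G p q →ₗ[ℝ] NerveForm I G p (q + 1) :=
  (-1 : ℝ) ^ p • DForm.d

variable (G) in
/-- The degree `n` part `⊕_{p+q=n} Ω^{p,q}(NG)` of the total complex `Ω^*(NG)`. -/
def Total (n : ℕ) := ∀ k : {k : ℕ × ℕ // k.1 + k.2 = n}, NerveForm I G k.1.1 k.1.2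

instance (n : ℕ) : AddCommGroup (Total I G n) :=
  inferInstanceAs (AddCommGroup (∀ k : {k : ℕ × ℕ // k.1 + k.2 = n}, NerveForm I G k.1.1 k.1.2))

instance (n : ℕ) : Module ℝ (Total I G n) :=
  inferInstanceAs (Module ℝ (∀ k : {k : ℕ × ℕ // k.1 + k.2 = n}, NerveForm I G k.1.1 k.1.2))

variable (G) in
/-- The total differential `D = d' + d''`. -/
def totalD (n : ℕ) : Total I G n →ₗ[ℝ] Total I G (n + 1) where
  toFun a
    | ⟨(0, 0), _⟩ => 0
    | ⟨(p + 1, 0), h⟩ => dHor I (a ⟨(p, 0), by simpa using h⟩)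
    | ⟨(0, q + 1), h⟩ => dVer I (a ⟨(0, q), by simpa using h⟩)
    | ⟨(p + 1, q + 1), h⟩ => dHor I (a ⟨(p, q + 1), by simp only at h ⊢; omega⟩) +
        dVer I (a ⟨(p + 1, q), by simp only at h ⊢; omega⟩)
  map_add' a b := by
    funext ⟨⟨p, q⟩, h⟩
    rcases p with _ | p <;> rcases q with _ | q
    · exact (add_zero 0).symm
    · exact map_add (dVer I) _ _
    · exact map_add (dHor I) _ _
    · exact (congrArg₂ (· + ·) (map_add (dHor I) _ _) (map_add (dVer I) _ _)).trans
        (add_add_add_comm _ _ _ _)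
  map_smul' c a := by
    funext ⟨⟨p, q⟩, h⟩
    rcases p with _ | p <;> rcases q with _ | q
    · exact (smul_zero c).symm
    · exact map_smul (dVer I) c _
    · exact map_smul (dHor I) c _
    · exact (congrArg₂ (· + ·) (map_smul (dHor I) c _) (map_smul (dVer I) c _)).trans
        (smul_add c _ _).symm

variable (G) in
/-- The cocycles of degree `n` in the total complex. -/
def cocycles (n : ℕ) : Submodule ℝ (Total I G n) := LinearMap.ker (totalD I G n)

variable (G) in
/-- The coboundaries of degree `n` in the total complex. -/
def coboundaries : (n : ℕ) → Submodule ℝ (Total I G n)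
  | 0 => ⊥
  | n + 1 => LinearMap.range (totalD I G n)

variable (G) in
/-- The cohomology `H^n(Ω(NG))` of the total complex. -/
abbrev TotalCohomology (n : ℕ) :=
  cocycles I G n ⧸ (coboundaries I G n).comap (cocycles I G n).subtype

/-- The class of a cocycle in `H^n(Ω(NG))`. -/
def cohomologyClass {n : ℕ} (a : Total I G n) (ha : a ∈ cocycles I G n) : TotalCohomology I G n :=
  Submodule.Quotient.mk ⟨a, ha⟩

end Nerve

section Extension
variable {E H : Type*} [NormedAddCommGroup E] [NormedSpace ℝ E] [TopologicalSpace H]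
  (I : ModelWithCorners ℝ E H) (G : Type*) [TopologicalSpace G] [ChartedSpace H G] [Group G]
  {E' H' : Type*} [NormedAddCommGroup E'] [NormedSpace ℝ E'] [TopologicalSpace H']
  (J : ModelWithCorners ℝ E' H') (Gh : Type*) [TopologicalSpace Gh] [ChartedSpace H' Gh] [Group Gh]

/-- A central extension `1 → U(1) → Ĝ → G → 1` of Lie groups such that `ρ : Ĝ → G` is a
(locally trivial, smooth) principal `U(1)`-bundle. -/
structure CentralExtension where
  /-- the inclusion `U(1) → Ĝ` -/
  ι : Circle →* Gh
  /-- the projection `Ĝ → G` -/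
  ρ : Gh →* G
  contMDiff_ι : ContMDiff (𝓡 1) J ∞ ι
  contMDiff_ρ : ContMDiff J I ∞ ρ
  injective_ι : Function.Injective ι
  surjective_ρ : Function.Surjective ρ
  range_ι : ι.range = ρ.ker
  central : ι.range ≤ Subgroup.center Gh
  /-- Near every point there are a smooth local section `η` and a smooth fibre coordinate `χ` such
  that `(h, u) ↦ η(h) u` and `x ↦ (ρ(x), χ(x))` are mutually inverse: a local trivialization. -/
  locally_trivial : ∀ g : G, ∃ V : Set G, IsOpen V ∧ g ∈ V ∧ ∃ (η : G → Gh) (χ : Gh → Circle),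
    ContMDiffOn I J ∞ η V ∧ ContMDiffOn J (𝓡 1) ∞ χ (ρ ⁻¹' V) ∧
    (∀ h ∈ V, ρ (η h) = h) ∧ ∀ x ∈ ρ ⁻¹' V, x = η (ρ x) * ι (χ x)

variable {I G J Gh}

/-- The map `Ω^q(M; iℝ) → Ω^q(M; ℝ)`, multiplication by `-1/(2πi)`. It is written on complex-valued
forms; on forms with purely imaginary values the product is real, and taking the real part only
adjusts the type of the values. -/
def normalize {q : ℕ} : DForm I G ℂ q →ₗ[ℝ] DForm I G ℝ q :=
  DForm.mapCoeff (Complex.reCLM ∘L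
    ContinuousLinearMap.mul ℝ ℂ (-1 / (2 * (Real.pi : ℂ) * Complex.I)))

namespace CentralExtension
variable (C : CentralExtension I G J Gh)

/-- A connection on the principal `U(1)`-bundle `ρ : Ĝ → G`: a smooth 1-form `θ` on `Ĝ` with values
in `Lie U(1) = iℝ` that is invariant under the action of `U(1)` and takes the value `i` on the
fundamental vector field `d/dt (x e^{it})` at `t = 0`. -/
structure Connection where
  /-- the connection form -/
  form : DForm J Gh ℂ 1
  imaginary : ∀ (x : Gh) (v : Fin 1 → TangentSpace J x), (form.1 x v).re = 0
  invariant : ∀ u : Circle, FormField.pullback (fun x : Gh => x * C.ι u) form.1 = form.1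
  vertical : ∀ x : Gh, form.1 (x * C.ι (Circle.exp 0))
    (fun _ => mfderiv 𝓘(ℝ, ℝ) J (fun t : ℝ => x * C.ι (Circle.exp t)) 0 (1 : ℝ)) = Complex.I

/-- The triples `(x₀, x₁, x₂)` of points of `Ĝ` over `ε_0(g), ε_1(g), ε_2(g)`, that is, the fibre
over `g ∈ NG(2)` of `ε_0^*Ĝ × ε_1^*Ĝ × ε_2^*Ĝ`. -/
def Triple (g : Nerve G 2) := {x : Fin 3 → Gh // ∀ i, C.ρ (x i) = face (p := 1) i g 0}

/-- Two triples have the same image in `ε_0^*Ĝ ⊗ (ε_1^*Ĝ)^{⊗-1} ⊗ ε_2^*Ĝ` if they differ by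
`(u₀, u₁, u₂)` with `u₀ u₁⁻¹ u₂ = 1`. -/
def tripleSetoid (g : Nerve G 2) : Setoid (C.Triple g) where
  r x y := ∃ u : Fin 3 → Circle, u 0 * (u 1)⁻¹ * u 2 = 1 ∧ ∀ i, y.1 i = x.1 i * C.ι (u i)
  iseqv :=
    { refl := fun x => ⟨fun _ => 1, by simp, fun i => by simp⟩
      symm := by
        rintro x y ⟨u, hu, h⟩
        refine ⟨fun i => (u i)⁻¹, ?_, fun i => by simp [h i]⟩
        have := congrArg (fun z => z⁻¹) hu
        simpa [mul_comm, mul_assoc, mul_left_comm] using this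
      trans := by
        rintro x y z ⟨u, hu, h⟩ ⟨w, hw, k⟩
        refine ⟨fun i => u i * w i, ?_, fun i => by simp [h i, k i, mul_assoc]⟩
        calc u 0 * w 0 * (u 1 * w 1)⁻¹ * (u 2 * w 2)
            = (u 0 * (u 1)⁻¹ * u 2) * (w 0 * (w 1)⁻¹ * w 2) := by
              rw [mul_inv]; ac_rfl
          _ = 1 := by rw [hu, hw, one_mul] }

/-- The fibre over `g ∈ NG(2)` of `δĜ = ε_0^*Ĝ ⊗ (ε_1^*Ĝ)^{⊗-1} ⊗ ε_2^*Ĝ`. -/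
def DeltaFiber (g : Nerve G 2) := Quotient (C.tripleSetoid g)

/-- `η = (η₀, η₁, η₂)` is a smooth lift over `V ⊆ NG(2)` of the section `s` of `δĜ` to
`ε_0^*Ĝ × ε_1^*Ĝ × ε_2^*Ĝ`, that is, `s = η₀ ⊗ η₁^{⊗-1} ⊗ η₂` on `V`. -/
def IsLift (s : ∀ g, C.DeltaFiber g) (V : Set (Nerve G 2)) (η : Fin 3 → Nerve G 2 → Gh) : Prop :=
  (∀ i, ContMDiffOn (nerveModel I 2) J ∞ (η i) V) ∧
  ∀ g ∈ V, ∃ h : ∀ i, C.ρ (η i g) = face (p := 1) i g 0,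
    s g = Quotient.mk (C.tripleSetoid g) ⟨fun i => η i g, h⟩

/-- Smooth global sections of `δĜ`. As `ε_0^*Ĝ × ε_1^*Ĝ × ε_2^*Ĝ → δĜ` is a surjective submersion,
a section is smooth if and only if it has smooth lifts locally. -/
def IsSmoothSection (s : ∀ g, C.DeltaFiber g) : Prop :=
  ∀ g, ∃ V, IsOpen V ∧ g ∈ V ∧ ∃ η, C.IsLift s V η

/-- The section of `δĜ` given by the multiplication of `Ĝ`: its value at `(g₁, g₂)` is
`ĝ₂ ⊗ (ĝ₁ ĝ₂)^{⊗-1} ⊗ ĝ₁` for any `ĝ₁, ĝ₂` over `g₁, g₂`. -/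
def canonicalSection (g : Nerve G 2) : C.DeltaFiber g :=
  Quotient.mk (C.tripleSetoid g)
    ⟨![Function.surjInv C.surjective_ρ (g 1),
      Function.surjInv C.surjective_ρ (g 0) * Function.surjInv C.surjective_ρ (g 1),
      Function.surjInv C.surjective_ρ (g 0)], by
      intro i
      fin_cases i <;> simp [face, Function.surjInv_eq]⟩

variable [LieGroup I ∞ G] [I.Boundaryless] [LieGroup J ∞ Gh] [J.Boundaryless]
variable {C}

/-- `c` is a 2-form on `G` with `ρ^* c = (-1/(2πi)) dθ`. -/
def IsChernForm (θ : C.Connection) (c : DForm I G ℝ 2) : Prop :=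
  DForm.pullback C.ρ C.contMDiff_ρ c = normalize (DForm.d θ.form)

open Classical in
/-- `c₁(θ)`, the 2-form on `G` with `ρ^* c₁(θ) = (-1/(2πi)) dθ`. -/
def chernForm (θ : C.Connection) : DForm I G ℝ 2 :=
  if h : ∃ c, IsChernForm θ c then h.choose else 0

/-- `β` is the pull-back `s^*(δθ)`. The induced connection `δθ` on `δĜ` is the form whose pull-back
to `ε_0^*Ĝ × ε_1^*Ĝ × ε_2^*Ĝ` is `pr₀^*θ - pr₁^*θ + pr₂^*θ`, so `s^*(δθ)` is
`η₀^*θ - η₁^*θ + η₂^*θ` for every local lift `η` of `s`. -/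
def IsDeltaPullback (θ : C.Connection) (s : ∀ g, C.DeltaFiber g)
    (β : DForm (nerveModel I 2) (Nerve G 2) ℂ 1) : Prop :=
  ∀ V η, IsOpen V → C.IsLift s V η → ∀ g ∈ V,
    β.1 g = ∑ i : Fin 3, (-1 : ℝ) ^ i.val • FormField.pullback (I := nerveModel I 2) (η i) θ.form.1 g

open Classical in
/-- `s^*(δθ)`, a 1-form on `NG(2)` with values in `iℝ`. -/
def deltaPullback (θ : C.Connection) (s : ∀ g, C.DeltaFiber g) :
    DForm (nerveModel I 2) (Nerve G 2) ℂ 1 :=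
  if h : ∃ β, IsDeltaPullback θ s β then h.choose else 0

/-- The cochain `c₁(θ) - (-1/(2πi)) s^*(δθ)` of degree 3, with components `c₁(θ)` on `NG(1) = G` and
`-(-1/(2πi)) s^*(δθ)` on `NG(2)`. -/
def ddCochain (θ : C.Connection) (s : ∀ g, C.DeltaFiber g) : Total I G 3
  | ⟨(1, 2), _⟩ => DForm.pullback (fun g : Nerve G 1 => g 0) (contMDiff_eval (fun _ => I) 0)
      (chernForm θ)
  | ⟨(2, 1), _⟩ => -normalize (deltaPullback θ s)
  | _ => 0

end CentralExtension
end Extension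

end SimplicialDeRham

end

/-! Everything rests on one formula. If two smooth maps `f`, `f'` to `Ĝ` lie over the same map to
`G`, then locally `f' = f · ι(u)` with `u` smooth and circle-valued (`exists_smooth_eq_mul_ι`), and
`f'^*θ = f^*θ + u^*μ` (`pullback_mul_ι`). Here `μ` is the Maurer-Cartan form of the circle. It is
the restriction of every connection to every fibre, it is closed, and it turns products of
circle-valued functions into sums.

Since `μ` is closed and does not depend on `θ`, both `dθ` and the difference of two connections are
unchanged when `f` is replaced by `f'`. They therefore descend to unique forms on `G`
(`exists_pullback_ρ_eq`, `pullback_ρ_injective`), which gives `c₁(θ)` and a one-form `γ` with `ρ^*γ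
= θ₁ - θ₀`. Two lifts of a section of `δĜ` differ by `u₀, u₁, u₂` with `u₁ = u₀u₂`, so the `μ`-terms
cancel in the alternating sum and `s^*(δθ)` is well defined (`Connection.sum_pullback_eq`).

As `ρ ∘ ηᵢ = εᵢ` for a lift `η`, differentiating the local expression of `s^*(δθ)` gives the
alternating face sum of the curvature (`d_deltaPullback`), and changing the connection adds the face
sum of `γ` (`deltaPullback_sub`). For the canonical section the face sum of `s^*(δθ)` vanishes
because multiplication in `Ĝ` is associative. Together with closedness of the curvature this is the
cocycle condition. For any smooth section, up to sign and the factor `-1/(2πi)`, `γ` in bidegree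
`(1, 1)` is a primitive of the difference of the two cochains (`exists_ddCochain_sub_eq`). -/

noncomputable section

namespace SimplicialDeRham

/-! ### Local calculus of differential forms on manifolds. -/

section Forms
variable {E H : Type*} [NormedAddCommGroup E] [NormedSpace ℝ E] [TopologicalSpace H]
  {I : ModelWithCorners ℝ E H} {M : Type*} [TopologicalSpace M] [ChartedSpace H M]
variable {E' H' N : Type*} [NormedAddCommGroup E'] [NormedSpace ℝ E'] [TopologicalSpace H']
  {I' : ModelWithCorners ℝ E' H'} [TopologicalSpace N] [ChartedSpace H' N]
variable {E'' H'' P : Type*} [NormedAddCommGroup E''] [NormedSpace ℝ E''] [TopologicalSpace H'']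
  {I'' : ModelWithCorners ℝ E'' H''} [TopologicalSpace P] [ChartedSpace H'' P]
variable {F F' : Type*} [NormedAddCommGroup F] [NormedSpace ℝ F]
  [NormedAddCommGroup F'] [NormedSpace ℝ F']

namespace FormField

/-- Smoothness of a field of forms near a point. -/
def SmoothAt {q : ℕ} (α : FormField I M F q) (x : M) : Prop :=
  ContDiffAt ℝ ∞ (α.inChart x) (extChartAt I x x)

theorem pullback_congr {q : ℕ} {f f' : M → N} (α : FormField I' N F q) {x : M}
    (h : f =ᶠ[𝓝 x] f') :
    pullback (I := I) f α x = pullback (I := I) f' α x :=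
  comp_congr (E' := E) α h.eq_of_nhds h.mfderiv_eq

theorem pullback_comp {q : ℕ} {g : N → P} {f : M → N} (α : FormField I'' P F q) {x : M}
    (hg : MDifferentiableAt I' I'' g (f x)) (hf : MDifferentiableAt I I' f x) :
    pullback (I := I) (fun y => g (f y)) α x =
      pullback (I := I) f (pullback (I := I') g α) x :=
  comp_congr (E' := E) α rfl (mfderiv_comp x hg hf)

theorem pullback_eq_of_eq {q : ℕ} {f : M → N} {α β : FormField I' N F q} {x : M}
    (h : α (f x) = β (f x)) : pullback (I := I) f α x = pullback (I := I) f β x := by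
  change (α (f x)).compContinuousLinearMap _ = (β (f x)).compContinuousLinearMap _
  rw [h]

theorem pullback_of_eventuallyEq_id {q : ℕ} {f : M → M} (α : FormField I M F q) {x : M}
    (h : ∀ᶠ y in 𝓝 x, f y = y) : pullback (I := I) f α x = α x := by
  rw [pullback_congr (f' := fun y => y) α h, pullback_id]

theorem map_of_eq_add (L : E [⋀^Fin 1]→L[ℝ] F) {a b c : Fin 1 → E} (h : a 0 = b 0 + c 0) :
    L a = L b + L c := by
  have e : ∀ w : Fin 1 → E, w = Function.update (0 : Fin 1 → E) 0 (w 0) := fun w => by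
    funext i; fin_cases i; rfl
  rw [e a, h, L.map_update_add, ← e b, ← e c]

/-- The derivative of a function of two variables, evaluated by a one-form. -/
theorem pullback_prod {Q E₃ H₃ : Type*} [NormedAddCommGroup E₃] [NormedSpace ℝ E₃]
    [TopologicalSpace H₃] {I₃ : ModelWithCorners ℝ E₃ H₃} [TopologicalSpace Q] [ChartedSpace H₃ Q]
    {Φ : N × P → Q} {f : M → N} {u : M → P} (α : FormField I₃ Q F 1) {x : M}
    (hΦ : MDifferentiableAt (I'.prod I'') I₃ Φ (f x, u x))
    (hf : MDifferentiableAt I I' f x) (hu : MDifferentiableAt I I'' u x) :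
    pullback (I := I) (fun y => Φ (f y, u y)) α x =
      pullback (I := I) (fun y => Φ (f y, u x)) α x +
      pullback (I := I) (fun y => Φ (f x, u y)) α x := by
  have hc : ∀ w : TangentSpace I x, mfderiv I I₃ (fun y => Φ (f y, u y)) x w =
      (mfderiv I I₃ (fun y => Φ (f y, u x)) x w + mfderiv I I₃ (fun y => Φ (f x, u y)) x w : E₃) := by
    intro w
    have h1 : mfderiv I I₃ (fun y => Φ (f y, u y)) x w = mfderiv (I'.prod I'') I₃ Φ (f x, u x)
        (mfderiv I (I'.prod I'') (fun y => (f y, u y)) x w) :=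
      mfderiv_comp_apply x (f := fun y => (f y, u y)) hΦ (hf.prodMk hu) w
    have h2 := mfderiv_comp_apply x (g := fun n => Φ (n, u x)) (f := f) (I' := I') (I'' := I₃)
      (MDifferentiableAt.comp (f := fun n => (n, u x)) (f x) hΦ
        (mdifferentiableAt_id.prodMk mdifferentiableAt_const)) hf w
    have h3 := mfderiv_comp_apply x (g := fun n => Φ (f x, n)) (f := u) (I' := I'') (I'' := I₃)
      (MDifferentiableAt.comp (f := fun n => (f x, n)) (u x) hΦ
        (mdifferentiableAt_const.prodMk mdifferentiableAt_id)) hu w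
    rw [h1, mfderiv_prod_eq_add_apply hΦ, mfderiv_prodMk hf hu]
    exact (congrArg₂ (fun a b : E₃ => a + b) h2 h3).symm
  -- Typing the form on the model space `E₃` lets the three derivatives be added as vectors of one
  -- space.
  ext v
  let L : E₃ [⋀^Fin 1]→L[ℝ] F := α (Φ (f x, u x))
  change L (fun i => mfderiv I I₃ (fun y => Φ (f y, u y)) x (v i)) =
    L (fun i => mfderiv I I₃ (fun y => Φ (f y, u x)) x (v i)) +
    L (fun i => mfderiv I I₃ (fun y => Φ (f x, u y)) x (v i))
  exact map_of_eq_add L (hc (v 0))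

theorem inChart_congr {q : ℕ} {α β : FormField I M F q} {x : M} (h : ∀ᶠ y in 𝓝 x, α y = β y) :
    α.inChart x =ᶠ[𝓝 (extChartAt I x x)] β.inChart x := by
  have hc := continuousAt_extChartAt_symm (I := I) x
  rw [ContinuousAt, extChartAt_to_inv] at hc
  filter_upwards [hc.eventually h] with z hz
  rw [inChart, inChart, hz]

theorem SmoothAt.congr {q : ℕ} {α β : FormField I M F q} {x : M} (hβ : β.SmoothAt x)
    (h : ∀ᶠ y in 𝓝 x, α y = β y) : α.SmoothAt x :=
  ContDiffAt.congr_of_eventuallyEq hβ (inChart_congr h)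

theorem SmoothAt.sum {q : ℕ} {ι : Type*} {s : Finset ι} {α : ι → FormField I M F q} {x : M}
    (h : ∀ i ∈ s, (α i).SmoothAt x) : SmoothAt (∑ i ∈ s, α i) x := by
  classical
  induction s using Finset.induction_on with
  | empty => exact (DForm I M F q).zero_mem x
  | insert i s hi ih =>
    rw [Finset.sum_insert hi]
    exact ContDiffAt.add (h i (Finset.mem_insert_self i s))
      (ih fun j hj => h j (Finset.mem_insert_of_mem hj))

theorem SmoothAt.smul {q : ℕ} (c : ℝ) {α : FormField I M F q} {x : M} (h : α.SmoothAt x) :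
    SmoothAt (c • α) x :=
  ContDiffAt.const_smul c h

theorem extDeriv_congr {q : ℕ} {α β : FormField I M F q} {x : M}
    (h : ∀ᶠ y in 𝓝 x, α y = β y) : extDeriv α x = extDeriv β x := by
  rw [extDeriv, extDeriv, (inChart_congr h).extDeriv_eq]

theorem extDeriv_add {q : ℕ} {α β : FormField I M F q} {x : M} (hα : α.SmoothAt x)
    (hβ : β.SmoothAt x) : extDeriv (α + β) x = extDeriv α x + extDeriv β x := by
  ext v
  change (_root_.extDeriv (α.inChart x + β.inChart x) (extChartAt I x x)) _ = _
  rw [_root_.extDeriv_add (ContDiffAt.differentiableAt hα (by simp))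
    (ContDiffAt.differentiableAt hβ (by simp))]
  rfl

theorem extDeriv_smul {q : ℕ} (c : ℝ) (α : FormField I M F q) (x : M) :
    extDeriv (c • α) x = c • extDeriv α x := by
  ext v
  change (_root_.extDeriv (c • α.inChart x) (extChartAt I x x)) _ = _
  rw [_root_.extDeriv_smul]
  rfl

theorem extDeriv_sum {q : ℕ} {ι : Type*} {s : Finset ι} {α : ι → FormField I M F q} {x : M}
    (h : ∀ i ∈ s, (α i).SmoothAt x) :
    extDeriv (∑ i ∈ s, α i) x = ∑ i ∈ s, extDeriv (α i) x := by
  classical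
  induction s using Finset.induction_on with
  | empty =>
    have := extDeriv_smul (0 : ℝ) (0 : FormField I M F q) x
    simpa using this
  | insert i s hi ih =>
    rw [Finset.sum_insert hi, Finset.sum_insert hi,
      extDeriv_add (h i (Finset.mem_insert_self i s))
        (SmoothAt.sum fun j hj => h j (Finset.mem_insert_of_mem hj)),
      ih fun j hj => h j (Finset.mem_insert_of_mem hj)]

/-- A field of forms is determined at a point by its expression in the chart there. -/
theorem eq_of_inChart_eq [IsManifold I ∞ M] [I.Boundaryless] {q : ℕ} {α β : FormField I M F q}
    {x : M} (h : α.inChart x (extChartAt I x x) = β.inChart x (extChartAt I x x)) :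
    α x = β x := by
  have h3 : (mfderiv 𝓘(ℝ, E) I (extChartAt I x).symm (extChartAt I x x)).comp
      (mfderiv I 𝓘(ℝ, E) (extChartAt I x) x) = ContinuousLinearMap.id ℝ E := by
    have := mfderivWithin_extChartAt_symm_comp_mfderiv_extChartAt' (I := I)
      (mem_extChartAt_source (I := I) x)
    rwa [I.range_eq_univ, mfderivWithin_univ] at this
  -- Pulling the chart expression back along the chart recovers the form, since the two derivatives
  -- compose to the identity.
  have key : ∀ γ : FormField I M F q, γ.toModel x =
      (γ.inChart x (extChartAt I x x)).compContinuousLinearMap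
        (mfderiv I 𝓘(ℝ, E) (extChartAt I x) x) := by
    intro γ
    have h4 : γ.inChart x (extChartAt I x x) = (γ.toModel x).compContinuousLinearMap
        (mfderiv 𝓘(ℝ, E) I (extChartAt I x).symm (extChartAt I x x)) :=
      comp_congr (E' := E) γ (extChartAt_to_inv x) rfl
    rw [h4]
    ext v
    change _ = γ.toModel x (fun i => (mfderiv 𝓘(ℝ, E) I (extChartAt I x).symm
      (extChartAt I x x)).comp (mfderiv I 𝓘(ℝ, E) (extChartAt I x) x) (v i))
    rw [h3]
    rfl
  have := key α
  rw [h, ← key β] at this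
  exact this

/-- The exterior derivative commutes with pull-backs. -/
theorem extDeriv_pullback [IsManifold I ∞ M] [IsManifold I' ∞ N] [I.Boundaryless]
    [I'.Boundaryless] {q : ℕ} {f : M → N} {α : FormField I' N F q} (h : α.IsSmooth) {x : M}
    (hf : ContMDiffAt I I' ∞ f x) :
    extDeriv (pullback (I := I) f α) x = pullback (I := I) f (extDeriv α) x := by
  have hF := contDiffAt_inCharts (I := I) (I' := I') x (f x) (mem_extChartAt_source x)
    (mem_extChartAt_source (f x)) hf
  have hFx : (extChartAt I' (f x) ∘ f ∘ (extChartAt I x).symm) (extChartAt I x x)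
      = extChartAt I' (f x) (f x) := by
    simp only [Function.comp_apply, extChartAt_to_inv]
  have h1 := inChart_pullback_eventuallyEq (I := I) α x (f x) (mem_extChartAt_source x)
    (mem_extChartAt_source (f x)) hf
  have h2 := inChart_pullback (I := I) (extDeriv α) x (f x) (mem_extChartAt_source x)
    (mem_extChartAt_source (f x)) (hf.mdifferentiableAt (by simp))
  -- In charts the claim is naturality of the exterior derivative on normed spaces, applied to the
  -- coordinate expression of `f`.
  have h3 : (_root_.extDeriv ((pullback (I := I) f α).inChart x) (extChartAt I x x)) =
      (pullback (I := I) f (extDeriv α)).inChart x (extChartAt I x x) := by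
    rw [h1.extDeriv_eq, _root_.extDeriv_pullback (r := ∞) ?_ hF (by simpa using ENat.LEInfty.out),
      h2, hFx, inChart_extDeriv h _ (mem_extChartAt_source (f x))]
    rw [hFx]
    exact (h (f x)).differentiableAt (by simp)
  refine eq_of_inChart_eq ?_
  rw [← h3]
  -- the exterior derivative at `x` in the chart around `x`
  have h4 : (mfderiv I 𝓘(ℝ, E) (extChartAt I x) x).comp
      (mfderiv 𝓘(ℝ, E) I (extChartAt I x).symm (extChartAt I x x)) = ContinuousLinearMap.id ℝ E := by
    have := mfderiv_extChartAt_comp_mfderivWithin_extChartAt_symm' (I := I)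
      (mem_extChartAt_source (I := I) x)
    rwa [I.range_eq_univ, mfderivWithin_univ] at this
  refine (comp_congr (extDeriv (pullback (I := I) f α)) (extChartAt_to_inv x) rfl).trans ?_
  ext v
  change (_root_.extDeriv ((pullback (I := I) f α).inChart x) (extChartAt I x x)) (fun i =>
    (mfderiv I 𝓘(ℝ, E) (extChartAt I x) x).comp
    (mfderiv 𝓘(ℝ, E) I (extChartAt I x).symm (extChartAt I x x)) (v i)) = _
  rw [h4]
  rfl

end FormField

namespace DForm
variable [IsManifold I ∞ M] [IsManifold I' ∞ N] [I.Boundaryless] [I'.Boundaryless]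

theorem d_pullback {q : ℕ} {f : M → N} (hf : ContMDiff I I' ∞ f) (α : DForm I' N F q) :
    d (pullback f hf α) = pullback f hf (d α) :=
  Subtype.ext <| funext fun x => FormField.extDeriv_pullback α.2 (hf x)

/-- On a whole neighbourhood of the chart point, the expression of `dα` is the flat exterior
derivative of the expression of `α`, so the identity reduces to the one on normed spaces. -/
theorem d_d {q : ℕ} (α : DForm I M F q) : d (d α) = 0 := by
  refine Subtype.ext <| funext fun x => ?_
  have h1 : (FormField.extDeriv α.1).inChart x =ᶠ[𝓝 (extChartAt I x x)]
      _root_.extDeriv (α.1.inChart x) := by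
    filter_upwards [(isOpen_extChartAt_target x).mem_nhds
      ((extChartAt I x).map_source (mem_extChartAt_source x))] with z hz
    have := FormField.inChart_extDeriv α.2 x ((extChartAt I x).map_target hz)
    rwa [(extChartAt I x).right_inv hz] at this
  change (_root_.extDeriv ((FormField.extDeriv α.1).inChart x) (extChartAt I x x)).compContinuousLinearMap
    _ = 0
  rw [h1.extDeriv_eq, extDeriv_extDeriv_apply (α.2 x) (by simpa using ENat.LEInfty.out)]
  rfl

/-- A constant linear map on values commutes with differentiation and with alternating sums. This
moves `normalize` past `d`. -/
theorem d_mapCoeff {q : ℕ} (L : F →L[ℝ] F') (α : DForm I M F q) :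
    d (mapCoeff L α) = mapCoeff L (d α) := by
  refine Subtype.ext <| funext fun x => ?_
  have hd : DifferentiableAt ℝ (α.1.inChart x) (extChartAt I x x) :=
    (α.2 x).differentiableAt (by simp)
  let T := ContinuousLinearMap.compContinuousAlternatingMapCLM ℝ E F F' (Fin q) L
  have h1 : fderiv ℝ ((mapCoeff L α).1.inChart x) (extChartAt I x x) =
      T.comp (fderiv ℝ (α.1.inChart x) (extChartAt I x x)) :=
    (T.hasFDerivAt.comp _ hd.hasFDerivAt).fderiv
  ext v
  change (_root_.extDeriv ((mapCoeff L α).1.inChart x) (extChartAt I x x)) _ =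
    L ((_root_.extDeriv (α.1.inChart x) (extChartAt I x x)) _)
  rw [_root_.extDeriv, _root_.extDeriv, h1]
  simp [ContinuousAlternatingMap.alternatizeUncurryFin_apply, T]

theorem pullback_mapCoeff {q : ℕ} (L : F →L[ℝ] F') {f : M → N} (hf : ContMDiff I I' ∞ f)
    (α : DForm I' N F q) : pullback f hf (mapCoeff L α) = mapCoeff L (pullback f hf α) := rfl

end DForm
end Forms

/-! ### Connections and their behaviour along the fibres of the extension. -/

section Extension
variable {E H : Type*} [NormedAddCommGroup E] [NormedSpace ℝ E] [TopologicalSpace H]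
  {I : ModelWithCorners ℝ E H} {G : Type*} [TopologicalSpace G] [ChartedSpace H G] [Group G]
  {E' H' : Type*} [NormedAddCommGroup E'] [NormedSpace ℝ E'] [TopologicalSpace H']
  {J : ModelWithCorners ℝ E' H'} {Gh : Type*} [TopologicalSpace Gh] [ChartedSpace H' Gh] [Group Gh]
  {F : Type*} [NormedAddCommGroup F] [NormedSpace ℝ F]
  {E₁ H₁ M : Type*} [NormedAddCommGroup E₁] [NormedSpace ℝ E₁] [TopologicalSpace H₁]
  {I₁ : ModelWithCorners ℝ E₁ H₁} [TopologicalSpace M] [ChartedSpace H₁ M]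

/-- One-forms on the circle agree if they agree on the tangent vectors of the curves `w e^{it}`,
provided that one of them does not vanish there. -/
theorem circle_oneForm_ext {α β : FormField (𝓡 1) Circle ℂ 1} {c : ℂ} (hc : c ≠ 0)
    (hα : ∀ w, FormField.pullback (I := 𝓘(ℝ, ℝ)) (fun t : ℝ => w * Circle.exp t) α 0
      (fun _ => (1 : ℝ)) = c)
    (hβ : ∀ w, FormField.pullback (I := 𝓘(ℝ, ℝ)) (fun t : ℝ => w * Circle.exp t) β 0
      (fun _ => (1 : ℝ)) = c) : α = β := by
  have key : ∀ w, α.toModel (w * Circle.exp 0) = β.toModel (w * Circle.exp 0) := by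
    intro w
    let ξ : EuclideanSpace ℝ (Fin 1) :=
      mfderiv 𝓘(ℝ, ℝ) (𝓡 1) (fun t : ℝ => w * Circle.exp t) 0 (1 : ℝ)
    have hα' : α.toModel (w * Circle.exp 0) (fun _ => ξ) = c := hα w
    have hβ' : β.toModel (w * Circle.exp 0) (fun _ => ξ) = c := hβ w
    -- The nonzero value `c` itself shows that the velocity of the curve is nonzero, hence spans the
    -- one-dimensional tangent space. The derivative of `Circle.exp` need not be computed.
    have hξ : ξ ≠ 0 := by
      intro h
      rw [h] at hα'
      exact hc (hα'.symm.trans ((α.toModel _).map_coord_zero 0 rfl))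
    ext v
    obtain ⟨r, hr⟩ := exists_smul_eq_of_finrank_eq_one (K := ℝ) (by simp) hξ (v 0)
    have hv : v = fun i => (fun _ : Fin 1 => r) i • (fun _ => ξ) i := by
      funext i; fin_cases i; exact hr.symm
    rw [hv, ContinuousAlternatingMap.map_smul_univ, ContinuousAlternatingMap.map_smul_univ,
      hα', hβ']
  funext w
  have := key w
  rw [Circle.exp_zero, mul_one] at this
  exact this

/-- Forms of degree two on the circle vanish. -/
theorem circle_twoForm_eq_zero (α : FormField (𝓡 1) Circle F 2) : α = 0 := by
  funext w
  change α.toModel w = 0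
  ext v
  by_contra h
  have := (α.toModel w).toAlternatingMap.map_linearDependent v (K := ℝ) ?_
  · exact h this
  · intro hv
    have := hv.fintype_card_le_finrank
    simp at this

namespace CentralExtension
variable (C : CentralExtension I G J Gh)

theorem exists_local_section (g : G) : ∃ V : Set G, IsOpen V ∧ g ∈ V ∧ ∃ η : G → Gh,
    ContMDiffOn I J ∞ η V ∧ ∀ h ∈ V, C.ρ (η h) = h := by
  obtain ⟨V, hV, hg, η, -, hη, -, hs, -⟩ := C.locally_trivial g
  exact ⟨V, hV, hg, η, hη, hs⟩

theorem ι_mul_comm (u : Circle) (x : Gh) : C.ι u * x = x * C.ι u :=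
  (Subgroup.mem_center_iff.1 (C.central ⟨u, rfl⟩) x).symm

theorem exists_eq_mul_ι {x y : Gh} (h : C.ρ y = C.ρ x) : ∃ u, y = x * C.ι u := by
  have : x⁻¹ * y ∈ C.ι.range := by
    rw [C.range_ι, MonoidHom.mem_ker, map_mul, map_inv, h, inv_mul_cancel]
  obtain ⟨u, hu⟩ := this
  exact ⟨u, by rw [hu, mul_inv_cancel_left]⟩

/-- Two smooth maps to `Ĝ` over the same map to `G` differ by a smooth function to the circle. -/
theorem exists_smooth_eq_mul_ι {f f' : M → Gh} {x : M} (hf : ContMDiffAt I₁ J ∞ f x)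
    (hf' : ContMDiffAt I₁ J ∞ f' x) (h : ∀ᶠ y in 𝓝 x, C.ρ (f' y) = C.ρ (f y)) :
    ∃ u : M → Circle, ContMDiffAt I₁ (𝓡 1) ∞ u x ∧ ∀ᶠ y in 𝓝 x, f' y = f y * C.ι (u y) := by
  obtain ⟨V, hV, hg, η, χ, -, hχ, -, ht⟩ := C.locally_trivial (C.ρ (f x))
  have hρ : ContinuousAt (fun y => C.ρ (f y)) x :=
    C.contMDiff_ρ.continuous.continuousAt.comp hf.continuousAt
  have hVo : IsOpen (C.ρ ⁻¹' V) := hV.preimage C.contMDiff_ρ.continuous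
  have hχ' : ∀ z ∈ C.ρ ⁻¹' V, ContMDiffAt J (𝓡 1) ∞ χ z := fun z hz =>
    hχ.contMDiffAt (hVo.mem_nhds hz)
  -- In a trivialization around `ρ(f x)` the two maps share the base point, so they differ by the
  -- quotient of their fibre coordinates.
  refine ⟨fun y => (χ (f y))⁻¹ * χ (f' y), ?_, ?_⟩
  · refine ContMDiffAt.mul (ContMDiffAt.inv ?_) ?_
    · exact (hχ' (f x) hg).comp x hf
    · refine (hχ' (f' x) ?_).comp x hf'
      change C.ρ (f' x) ∈ V
      rw [h.self_of_nhds]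
      exact hg
  · filter_upwards [h, hρ.eventually (hV.mem_nhds hg)] with y hy hyV
    have h1 := ht (f y) hyV
    have h2 := ht (f' y) (by change C.ρ (f' y) ∈ V; rw [hy]; exact hyV)
    rw [hy] at h2
    calc f' y = η (C.ρ (f y)) * C.ι (χ (f' y)) := h2
      _ = η (C.ρ (f y)) * C.ι (χ (f y)) * C.ι ((χ (f y))⁻¹ * χ (f' y)) := by
        rw [mul_assoc, ← map_mul, mul_inv_cancel_left]
      _ = _ := by rw [← h1]

variable [LieGroup J ∞ Gh]
variable {C}

theorem mdifferentiable_mul_ι (x : Gh) :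
    MDifferentiable (𝓡 1) J (fun w : Circle => x * C.ι w) :=
  (contMDiff_const.mul C.contMDiff_ι).mdifferentiable (by simp)

namespace Connection

/-- The restrictions of connection forms to the fibres are the Maurer-Cartan form of the circle. -/
theorem pullback_fiber_eq (θ θ' : C.Connection) (a b : Gh) :
    FormField.pullback (I := 𝓡 1) (fun w => a * C.ι w) θ.form.1 =
      FormField.pullback (I := 𝓡 1) (fun w => b * C.ι w) θ'.form.1 := by
  -- The curve `a ι(w e^{it})` is the vertical curve through `a ι(w)`, where every connection takes
  -- the value `i`.
  have key : ∀ (θ : C.Connection) (a : Gh) (w : Circle),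
      FormField.pullback (I := 𝓘(ℝ, ℝ)) (fun t : ℝ => w * Circle.exp t)
        (FormField.pullback (I := 𝓡 1) (fun w => a * C.ι w) θ.form.1) 0 (fun _ => (1 : ℝ)) =
      Complex.I := by
    intro θ a w
    rw [← FormField.pullback_comp (g := fun w => a * C.ι w) (f := fun t : ℝ => w * Circle.exp t)
      θ.form.1 (mdifferentiable_mul_ι a _)
      ((contMDiff_const.mul (contMDiff_circleExp (m := ∞))).mdifferentiable (by simp) 0)]
    have : (fun t : ℝ => a * C.ι (w * Circle.exp t)) =
        fun t => (a * C.ι w) * C.ι (Circle.exp t) := by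
      funext t
      rw [map_mul, mul_assoc]
    rw [this]
    exact θ.vertical (a * C.ι w)
  exact circle_oneForm_ext Complex.I_ne_zero (key θ a) (key θ' b)

variable [J.Boundaryless]

/-- The Maurer-Cartan form of the circle, as the restriction of a connection form. -/
def fiberForm (θ : C.Connection) : DForm (𝓡 1) Circle ℂ 1 :=
  DForm.pullback C.ι C.contMDiff_ι θ.form

theorem fiberForm_eq (θ θ' : C.Connection) : θ.fiberForm = θ'.fiberForm := by
  refine Subtype.ext ?_
  have := pullback_fiber_eq θ θ' 1 1
  simp only [one_mul] at this
  exact this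

/-- This is the product rule for `(z, w) ↦ z ι(w)`. With `w` frozen, invariance under the circle
removes the translation. With `z` frozen, the fibre restriction is the Maurer-Cartan form by
`pullback_fiber_eq`. -/
theorem pullback_mul_ι (θ : C.Connection) {f : M → Gh} {u : M → Circle} {x : M}
    (hf : MDifferentiableAt I₁ J f x) (hu : MDifferentiableAt I₁ (𝓡 1) u x) :
    FormField.pullback (I := I₁) (fun y => f y * C.ι (u y)) θ.form.1 x =
      FormField.pullback (I := I₁) f θ.form.1 x +
      FormField.pullback (I := I₁) u θ.fiberForm.1 x := by
  have hΦ : MDifferentiable (J.prod (𝓡 1)) J (fun p : Gh × Circle => p.1 * C.ι p.2) :=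
    (contMDiff_fst.mul (C.contMDiff_ι.comp contMDiff_snd)).mdifferentiable (by simp)
  rw [FormField.pullback_prod (Φ := fun p : Gh × Circle => p.1 * C.ι p.2) θ.form.1 (hΦ _) hf hu]
  congr 1
  · have hr : MDifferentiable J J (fun z : Gh => z * C.ι (u x)) :=
      (contMDiff_id.mul contMDiff_const : ContMDiff J J ∞ _).mdifferentiable (by simp)
    have := FormField.pullback_comp (g := fun z : Gh => z * C.ι (u x)) θ.form.1 (hr _) hf
    rw [θ.invariant] at this
    exact this
  · have := FormField.pullback_comp (g := fun w : Circle => f x * C.ι w) θ.form.1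
      (mdifferentiable_mul_ι _ _) hu
    refine this.trans ?_
    rw [pullback_fiber_eq θ θ (f x) 1]
    simp only [one_mul]
    rfl

/-- Apply `pullback_mul_ι` to `ι ∘ u` and use that `ι` is a homomorphism. -/
theorem fiberForm_pullback_mul (θ : C.Connection) {u w : M → Circle} {x : M}
    (hu : MDifferentiableAt I₁ (𝓡 1) u x) (hw : MDifferentiableAt I₁ (𝓡 1) w x) :
    FormField.pullback (I := I₁) (fun y => u y * w y) θ.fiberForm.1 x =
      FormField.pullback (I := I₁) u θ.fiberForm.1 x +
      FormField.pullback (I := I₁) w θ.fiberForm.1 x := by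
  have hι : MDifferentiable (𝓡 1) J C.ι := C.contMDiff_ι.mdifferentiable (by simp)
  have h1 := θ.pullback_mul_ι (f := fun y => C.ι (u y)) ((hι _).comp x hu) hw
  have hm : MDifferentiableAt I₁ (𝓡 1) (fun y => u y * w y) x :=
    ((contMDiff_mul (𝓡 1) ∞).mdifferentiable (by simp) _).comp x (hu.prodMk hw)
  rw [FormField.pullback_comp θ.form.1 (hι _) hu] at h1
  simp only [← map_mul] at h1
  rw [FormField.pullback_comp θ.form.1 (hι _) hm] at h1
  exact h1

/-- The correction term `u^*μ` is the same for both connections and cancels in the difference. -/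
theorem pullback_sub_eq (θ θ' : C.Connection) {f f' : M → Gh} {x : M}
    (hf : ContMDiffAt I₁ J ∞ f x) (hf' : ContMDiffAt I₁ J ∞ f' x)
    (h : ∀ᶠ y in 𝓝 x, C.ρ (f' y) = C.ρ (f y)) :
    FormField.pullback (I := I₁) f' (θ'.form - θ.form).1 x =
      FormField.pullback (I := I₁) f (θ'.form - θ.form).1 x := by
  obtain ⟨u, hu, hfu⟩ := C.exists_smooth_eq_mul_ι hf hf' h
  have key : ∀ θ : C.Connection, FormField.pullback (I := I₁) f' θ.form.1 x = _ := fun θ =>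
    (FormField.pullback_congr θ.form.1 hfu).trans
      (θ.pullback_mul_ι (hf.mdifferentiableAt (by simp)) (hu.mdifferentiableAt (by simp)))
  change FormField.pullback (I := I₁) f' θ'.form.1 x - FormField.pullback (I := I₁) f' θ.form.1 x =
    FormField.pullback (I := I₁) f θ'.form.1 x - FormField.pullback (I := I₁) f θ.form.1 x
  rw [key, key, fiberForm_eq θ' θ, add_sub_add_right_eq_sub]

theorem d_fiberForm (θ : C.Connection) : FormField.extDeriv θ.fiberForm.1 = 0 :=
  circle_twoForm_eq_zero _

/-- The curvature `dθ` is basic. -/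
theorem pullback_d_eq [IsManifold I₁ ∞ M] [I₁.Boundaryless] (θ : C.Connection) {f f' : M → Gh}
    {x : M} (hf : ContMDiffAt I₁ J ∞ f x) (hf' : ContMDiffAt I₁ J ∞ f' x)
    (h : ∀ᶠ y in 𝓝 x, C.ρ (f' y) = C.ρ (f y)) :
    FormField.pullback (I := I₁) f' (DForm.d θ.form).1 x =
      FormField.pullback (I := I₁) f (DForm.d θ.form).1 x := by
  obtain ⟨u, hu, hfu⟩ := C.exists_smooth_eq_mul_ι hf hf' h
  -- The formula is about to be differentiated, so it is needed near `x` and not only at `x`. Being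
  -- `C¹` spreads from a point to a neighbourhood and is enough for it.
  have e : ∀ᶠ y in 𝓝 x, FormField.pullback (I := I₁) f' θ.form.1 y =
      (FormField.pullback (I := I₁) f θ.form.1 +
        FormField.pullback (I := I₁) u θ.fiberForm.1) y := by
    have h1 : ∀ᶠ w in 𝓝 x, ContMDiffAt I₁ J 1 f w :=
      (contMDiffAt_iff_contMDiffAt_nhds (by simp)).1 (hf.of_le (by simp))
    have h2 : ∀ᶠ w in 𝓝 x, ContMDiffAt I₁ (𝓡 1) 1 u w :=
      (contMDiffAt_iff_contMDiffAt_nhds (by simp)).1 (hu.of_le (by simp))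
    filter_upwards [h1, h2, hfu.eventually_nhds] with y hy1 hy2 hy3
    exact (FormField.pullback_congr θ.form.1 hy3).trans
      (θ.pullback_mul_ι (hy1.mdifferentiableAt (by simp)) (hy2.mdifferentiableAt (by simp)))
  have h3 := FormField.extDeriv_congr e
  rw [FormField.extDeriv_add (FormField.contDiffAt_pullback θ.form.2 hf)
    (FormField.contDiffAt_pullback θ.fiberForm.2 hu),
    FormField.extDeriv_pullback θ.form.2 hf', FormField.extDeriv_pullback θ.form.2 hf,
    FormField.extDeriv_pullback θ.fiberForm.2 hu, d_fiberForm] at h3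
  refine h3.trans ?_
  have : FormField.pullback (I := I₁) u (0 : FormField (𝓡 1) Circle ℂ 2) x = 0 := rfl
  rw [this, add_zero]
  rfl

end Connection

/-! ### Descent of forms from `Ĝ` to `G`. -/

variable [J.Boundaryless] [LieGroup I ∞ G] [I.Boundaryless]

/-- A local section `η` satisfies `ρ ∘ η = id`, so `η^*` undoes `ρ^*` near each point. -/
theorem pullback_ρ_injective {q : ℕ} :
    Function.Injective (DForm.pullback (F := F) (q := q) C.ρ C.contMDiff_ρ) := by
  intro c c' h
  refine Subtype.ext <| funext fun g => ?_
  obtain ⟨V, hV, hg, η, hη, hs⟩ := C.exists_local_section g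
  have hη' := (hη.contMDiffAt (hV.mem_nhds hg)).mdifferentiableAt (by simp)
  have hρ : MDifferentiable J I C.ρ := C.contMDiff_ρ.mdifferentiable (by simp)
  have hid : ∀ᶠ y in 𝓝 g, C.ρ (η y) = y := by
    filter_upwards [hV.mem_nhds hg] with y hy using hs y hy
  have key : ∀ c : DForm I G F q, c.1 g =
      FormField.pullback (I := I) η (FormField.pullback (I := J) C.ρ c.1) g := fun c => by
    rw [← FormField.pullback_comp c.1 (hρ _) hη', FormField.pullback_of_eventuallyEq_id c.1 hid]
  rw [key c, key c']
  exact congrArg (fun τ : DForm J Gh F q => FormField.pullback (I := I) η τ.1 g) h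

/-- Forms on `Ĝ` that are invariant under smooth maps over `G` descend to `G`. -/
theorem exists_pullback_ρ_eq {q : ℕ} (α : DForm J Gh F q)
    (hα : ∀ (f : Gh → Gh) (x : Gh), ContMDiffAt J J ∞ f x → (∀ᶠ y in 𝓝 x, C.ρ (f y) = C.ρ y) →
      FormField.pullback (I := J) f α.1 x = α.1 x) :
    ∃ c : DForm I G F q, DForm.pullback C.ρ C.contMDiff_ρ c = α := by
  choose V hV hg η hη hs using C.exists_local_section
  have hρ : MDifferentiable J I C.ρ := C.contMDiff_ρ.mdifferentiable (by simp)
  have hη' : ∀ g, ∀ h ∈ V g, ContMDiffAt I J ∞ (η g) h := fun g h hh =>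
    (hη g).contMDiffAt ((hV g).mem_nhds hh)
  -- The composite of `ρ` with a local section is a map over `G`, so the invariance hypothesis
  -- applies to it.
  have key : ∀ g, ∀ x ∈ C.ρ ⁻¹' V g,
      FormField.pullback (I := J) C.ρ (FormField.pullback (I := I) (η g) α.1) x = α.1 x := by
    intro g x hx
    rw [← FormField.pullback_comp α.1 ((hη' g _ hx).mdifferentiableAt (by simp)) (hρ x)]
    refine hα _ _ ((hη' g _ hx).comp x (C.contMDiff_ρ x)) ?_
    filter_upwards [((hV g).preimage C.contMDiff_ρ.continuous).mem_nhds hx] with y hy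
    exact hs g _ hy
  let c : FormField I G F q := fun g => FormField.pullback (I := I) (η g) α.1 g
  -- `c` uses a different section at each point. Independence of the section lets one section
  -- compute `c` on all of `V g`, which gives smoothness.
  have hc : ∀ g, ∀ h ∈ V g, c h = FormField.pullback (I := I) (η g) α.1 h := by
    intro g h hh
    have h1 : MDifferentiableAt I J (η h) h := (hη' h h (hg h)).mdifferentiableAt (by simp)
    have hρh : C.ρ (η h h) = h := hs h h (hg h)
    change FormField.pullback (I := I) (η h) α.1 h = _
    rw [← FormField.pullback_eq_of_eq (key g (η h h) (by change C.ρ (η h h) ∈ V g; rwa [hρh])),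
      ← FormField.pullback_comp _ (hρ _) h1, FormField.pullback_of_eventuallyEq_id]
    filter_upwards [(hV h).mem_nhds (hg h)] with y hy using hs h y hy
  refine ⟨⟨c, fun g => FormField.SmoothAt.congr
    (FormField.contDiffAt_pullback α.2 (hη' g g (hg g))) ?_⟩, ?_⟩
  · filter_upwards [(hV g).mem_nhds (hg g)] with h hh using hc g h hh
  · refine Subtype.ext <| funext fun x => ?_
    rw [← key (C.ρ x) x (hg _)]
    exact FormField.pullback_eq_of_eq rfl

/-- The curvature of a connection descends to `G`. -/
theorem exists_pullback_ρ_eq_d (θ : C.Connection) :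
    ∃ c : DForm I G ℂ 2, DForm.pullback C.ρ C.contMDiff_ρ c = DForm.d θ.form :=
  exists_pullback_ρ_eq (C := C) _ fun f x hf h => by
    have := θ.pullback_d_eq (f := fun y => y) contMDiffAt_id hf h
    rwa [FormField.pullback_id] at this

/-- The curvature descends as a complex-valued form, and `normalize` commutes with pull-back. -/
theorem existsUnique_isChernForm (θ : C.Connection) : ∃! c, IsChernForm θ c := by
  obtain ⟨c, hc⟩ := exists_pullback_ρ_eq_d θ
  refine ⟨normalize c, ?_, fun c' hc' => pullback_ρ_injective (C := C) (hc'.trans ?_)⟩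
  · change DForm.pullback C.ρ C.contMDiff_ρ (normalize c) = normalize (DForm.d θ.form)
    rw [← hc]
    rfl
  · rw [← hc]
    rfl

theorem isChernForm_chernForm (θ : C.Connection) : IsChernForm θ (chernForm θ) := by
  have h := (existsUnique_isChernForm θ).exists
  rw [chernForm, dif_pos h]
  exact h.choose_spec

/-- The difference of two connections descends to `G`. -/
theorem exists_pullback_ρ_eq_sub (θ θ' : C.Connection) :
    ∃ γ : DForm I G ℂ 1, DForm.pullback C.ρ C.contMDiff_ρ γ = θ'.form - θ.form :=
  exists_pullback_ρ_eq (C := C) _ fun f x hf h => by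
    have := Connection.pullback_sub_eq θ θ' (f := fun y => y) contMDiffAt_id hf h
    rwa [FormField.pullback_id] at this

end CentralExtension
end Extension

/-! ### Sections of `δĜ` and the pull-back of the induced connection. -/

section Delta
variable {E H : Type*} [NormedAddCommGroup E] [NormedSpace ℝ E] [TopologicalSpace H]
  {I : ModelWithCorners ℝ E H} {G : Type*} [TopologicalSpace G] [ChartedSpace H G] [Group G]
  {E' H' : Type*} [NormedAddCommGroup E'] [NormedSpace ℝ E'] [TopologicalSpace H']
  {J : ModelWithCorners ℝ E' H'} {Gh : Type*} [TopologicalSpace Gh] [ChartedSpace H' Gh] [Group Gh]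
  {M : Type*}

namespace CentralExtension
variable {C : CentralExtension I G J Gh}

/-- `φ = (φ₀, φ₁, φ₂)` represents the section `s` of `δĜ` along `f` at `y`. -/
def Represents (s : ∀ g, C.DeltaFiber g) (f : M → Nerve G 2) (φ : Fin 3 → M → Gh) (y : M) : Prop :=
  ∃ h : ∀ i, C.ρ (φ i y) = face (p := 1) i (f y) 0,
    s (f y) = Quotient.mk (C.tripleSetoid (f y)) ⟨fun i => φ i y, h⟩

theorem Represents.exists_circle {s : ∀ g, C.DeltaFiber g} {f : M → Nerve G 2}
    {φ φ' : Fin 3 → M → Gh} {y : M} (h : Represents s f φ y) (h' : Represents s f φ' y) :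
    ∃ u : Fin 3 → Circle, u 0 * (u 1)⁻¹ * u 2 = 1 ∧ ∀ i, φ' i y = φ i y * C.ι (u i) := by
  obtain ⟨_, e⟩ := h
  obtain ⟨_, e'⟩ := h'
  exact Quotient.exact (e.symm.trans e')

/-- Replacing the chosen lifts by others multiplies them by `ι u` and `ι w`. As `ι` is central, the
product changes by `ι(uw)`, and `w (uw)⁻¹ u = 1`. -/
theorem canonicalSection_represents {f : M → Nerve G 2} {a b : M → Gh} {y : M}
    (ha : C.ρ (a y) = f y 0) (hb : C.ρ (b y) = f y 1) :
    Represents C.canonicalSection f ![b, fun y => a y * b y, a] y := by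
  have h : ∀ i, C.ρ ((![b, fun y => a y * b y, a] : Fin 3 → M → Gh) i y) =
      face (p := 1) i (f y) 0 := by
    intro i
    fin_cases i <;> simp [face, ha, hb]
  refine ⟨h, Quotient.sound ?_⟩
  obtain ⟨u, hu⟩ := C.exists_eq_mul_ι (x := Function.surjInv C.surjective_ρ (f y 0)) (y := a y)
    (by rw [ha, Function.surjInv_eq C.surjective_ρ])
  obtain ⟨w, hw⟩ := C.exists_eq_mul_ι (x := Function.surjInv C.surjective_ρ (f y 1)) (y := b y)
    (by rw [hb, Function.surjInv_eq C.surjective_ρ])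
  refine ⟨![w, u * w, u], by simp, fun i => ?_⟩
  fin_cases i
  · exact hw
  · change a y * b y = Function.surjInv C.surjective_ρ (f y 0) *
      Function.surjInv C.surjective_ρ (f y 1) * C.ι (u * w)
    rw [hu, hw, map_mul, mul_assoc, ← mul_assoc (C.ι u), C.ι_mul_comm]
    simp only [mul_assoc]
  · exact hu

variable {E₁ H₁ : Type*} [NormedAddCommGroup E₁] [NormedSpace ℝ E₁] [TopologicalSpace H₁]
  {I₁ : ModelWithCorners ℝ E₁ H₁} [TopologicalSpace M] [ChartedSpace H₁ M]

section
variable [LieGroup J ∞ Gh]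

/-- Local sections `a`, `b` of `ρ` around the two entries give the smooth lift `(b, ab, a)`. -/
theorem isSmoothSection_canonicalSection : C.IsSmoothSection C.canonicalSection := by
  intro g
  obtain ⟨V, hV, hgV, a, ha, hsa⟩ := C.exists_local_section (g 0)
  obtain ⟨W, hW, hgW, b, hb, hsb⟩ := C.exists_local_section (g 1)
  have he : ∀ i : Fin 2, ContMDiff (nerveModel I 2) I ∞ fun g : Nerve G 2 => g i := fun i =>
    contMDiff_eval (fun _ : Fin 2 => I) i
  refine ⟨{g | g 0 ∈ V ∧ g 1 ∈ W}, (hV.preimage (he 0).continuous).inter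
    (hW.preimage (he 1).continuous), ⟨hgV, hgW⟩,
    ![fun g => b (g 1), fun g => a (g 0) * b (g 1), fun g => a (g 0)], ?_, ?_⟩
  · have ha' : ContMDiffOn (nerveModel I 2) J ∞ (fun g : Nerve G 2 => a (g 0))
        {g | g 0 ∈ V ∧ g 1 ∈ W} := ha.comp (he 0).contMDiffOn fun g hg => hg.1
    have hb' : ContMDiffOn (nerveModel I 2) J ∞ (fun g : Nerve G 2 => b (g 1))
        {g | g 0 ∈ V ∧ g 1 ∈ W} := hb.comp (he 1).contMDiffOn fun g hg => hg.2
    intro i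
    fin_cases i
    · exact hb'
    · exact ha'.mul hb'
    · exact ha'
  · intro g hg
    exact canonicalSection_represents (f := fun g => g) (hsa _ hg.1) (hsb _ hg.2)

variable [J.Boundaryless]

/-- `φ₀^*θ - φ₁^*θ + φ₂^*θ` depends only on the section of `δĜ` represented by `φ`. -/
theorem Connection.sum_pullback_eq (θ : C.Connection) {s : ∀ g, C.DeltaFiber g}
    {f : M → Nerve G 2} {φ φ' : Fin 3 → M → Gh} {x : M}
    (hφ : ∀ i, ContMDiffAt I₁ J ∞ (φ i) x) (hφ' : ∀ i, ContMDiffAt I₁ J ∞ (φ' i) x)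
    (h : ∀ᶠ y in 𝓝 x, Represents s f φ y) (h' : ∀ᶠ y in 𝓝 x, Represents s f φ' y) :
    ∑ i : Fin 3, (-1 : ℝ) ^ i.val • FormField.pullback (I := I₁) (φ' i) θ.form.1 x =
      ∑ i : Fin 3, (-1 : ℝ) ^ i.val • FormField.pullback (I := I₁) (φ i) θ.form.1 x := by
  have hρ : ∀ i, ∀ᶠ y in 𝓝 x, C.ρ (φ' i y) = C.ρ (φ i y) := by
    intro i
    filter_upwards [h, h'] with y ⟨hy, _⟩ ⟨hy', _⟩
    rw [hy, hy']
  choose u hu hφu using fun i => C.exists_smooth_eq_mul_ι (hφ i) (hφ' i) (hρ i)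
  have hu' : ∀ i, MDifferentiableAt I₁ (𝓡 1) (u i) x := fun i =>
    (hu i).mdifferentiableAt (by simp)
  -- Equality in the tensor product gives circle elements `w` pointwise, with no regularity.
  -- Injectivity of `ι` identifies them with the smooth `u i`, which thus inherit the relation.
  have h1 : ∀ᶠ y in 𝓝 x, u 1 y = u 0 y * u 2 y := by
    filter_upwards [h, h', hφu 0, hφu 1, hφu 2] with y hy hy' h0 h1 h2
    obtain ⟨w, hw, hwφ⟩ := hy.exists_circle hy'
    have e : ∀ i, φ' i y = φ i y * C.ι (u i y) → u i y = w i := fun i hi =>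
      C.injective_ι (mul_left_cancel (hi.symm.trans (hwφ i)))
    rw [e 0 h0, e 1 h1, e 2 h2]
    rw [mul_right_comm, mul_inv_eq_one] at hw
    exact hw.symm
  have h2 := (FormField.pullback_congr (I := I₁) θ.fiberForm.1 h1).trans
    (θ.fiberForm_pullback_mul (hu' 0) (hu' 2))
  have key : ∀ i, FormField.pullback (I := I₁) (φ' i) θ.form.1 x = _ := fun i =>
    (FormField.pullback_congr θ.form.1 (hφu i)).trans
      (θ.pullback_mul_ι ((hφ i).mdifferentiableAt (by simp)) (hu' i))
  simp only [Fin.sum_univ_three, key, h2]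
  simp only [Fin.val_zero, Fin.val_one, Fin.val_two, pow_zero, pow_one, one_smul, neg_smul,
    neg_one_sq]
  abel

end

variable [LieGroup I ∞ G] [I.Boundaryless] [LieGroup J ∞ Gh] [J.Boundaryless]

/-- The local expressions agree on overlaps by `Connection.sum_pullback_eq`, so they glue.
Uniqueness holds because lifts exist around every point. -/
theorem existsUnique_isDeltaPullback (θ : C.Connection) {s : ∀ g, C.DeltaFiber g}
    (hs : C.IsSmoothSection s) : ∃! β, IsDeltaPullback θ s β := by
  choose V hV hg η hη using hs
  have hη' : ∀ {V : Set (Nerve G 2)} {η : Fin 3 → Nerve G 2 → Gh}, IsOpen V → C.IsLift s V η →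
      ∀ g ∈ V, ∀ i, ContMDiffAt (nerveModel I 2) J ∞ (η i) g := fun hV hη g hg i =>
    (hη.1 i).contMDiffAt (hV.mem_nhds hg)
  have hr : ∀ {V : Set (Nerve G 2)} {η : Fin 3 → Nerve G 2 → Gh}, IsOpen V → C.IsLift s V η →
      ∀ g ∈ V, ∀ᶠ y in 𝓝 g, Represents s (fun g => g) η y := fun hV hη g hg => by
    filter_upwards [hV.mem_nhds hg] with y hy using hη.2 y hy
  let S : Nerve G 2 → FormField (nerveModel I 2) (Nerve G 2) ℂ 1 := fun g =>
    ∑ i : Fin 3, (-1 : ℝ) ^ i.val • FormField.pullback (I := nerveModel I 2) (η g i) θ.form.1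
  have hS : ∀ g x, S g x = ∑ i : Fin 3, (-1 : ℝ) ^ i.val •
      FormField.pullback (I := nerveModel I 2) (η g i) θ.form.1 x := fun g x => by
    simp only [S, Finset.sum_apply]
    rfl
  -- `S g` is meaningful only near `g`, where its lift lives, so only its value at `g` is taken.
  let β : FormField (nerveModel I 2) (Nerve G 2) ℂ 1 := fun g => S g g
  have hβ : ∀ V' η', IsOpen V' → C.IsLift s V' η' → ∀ g ∈ V', β g = ∑ i : Fin 3,
      (-1 : ℝ) ^ i.val • FormField.pullback (I := nerveModel I 2) (η' i) θ.form.1 g := by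
    intro V' η' hV' hη₁ g hg'
    change S g g = _
    rw [hS]
    exact θ.sum_pullback_eq (hη' hV' hη₁ g hg') (hη' (hV g) (hη g) g (hg g))
      (hr hV' hη₁ g hg') (hr (hV g) (hη g) g (hg g))
  refine ⟨⟨β, fun g => ?_⟩, hβ, fun β' hβ' => Subtype.ext <| funext fun g => ?_⟩
  · refine FormField.SmoothAt.congr (β := S g) (FormField.SmoothAt.sum fun i _ =>
      FormField.SmoothAt.smul _ (FormField.contDiffAt_pullback θ.form.2
        (hη' (hV g) (hη g) g (hg g) i))) ?_
    filter_upwards [(hV g).mem_nhds (hg g)] with y hy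
    rw [hS]
    exact hβ _ _ (hV g) (hη g) y hy
  · exact (hβ' _ _ (hV g) (hη g) g (hg g)).trans (hβ _ _ (hV g) (hη g) g (hg g)).symm

theorem isDeltaPullback_deltaPullback (θ : C.Connection) {s : ∀ g, C.DeltaFiber g}
    (hs : C.IsSmoothSection s) : IsDeltaPullback θ s (deltaPullback θ s) := by
  have h := (existsUnique_isDeltaPullback θ hs).exists
  rw [deltaPullback, dif_pos h]
  exact h.choose_spec

/-- The pull-back of `s^*(δθ)` along a map, computed from any smooth representatives of `s` along
this map. -/
theorem pullback_deltaPullback (θ : C.Connection) {s : ∀ g, C.DeltaFiber g}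
    (hs : C.IsSmoothSection s) {f : M → Nerve G 2} {φ : Fin 3 → M → Gh} {x : M}
    (hf : ContMDiffAt I₁ (nerveModel I 2) ∞ f x) (hφ : ∀ i, ContMDiffAt I₁ J ∞ (φ i) x)
    (h : ∀ᶠ y in 𝓝 x, Represents s f φ y) :
    FormField.pullback (I := I₁) f (deltaPullback θ s).1 x =
      ∑ i : Fin 3, (-1 : ℝ) ^ i.val • FormField.pullback (I := I₁) (φ i) θ.form.1 x := by
  obtain ⟨V, hV, hg, η, hη⟩ := hs (f x)
  have hη' : ∀ i, ContMDiffAt (nerveModel I 2) J ∞ (η i) (f x) := fun i =>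
    (hη.1 i).contMDiffAt (hV.mem_nhds hg)
  have h1 := isDeltaPullback_deltaPullback θ hs V η hV hη (f x) hg
  -- A lift over a neighbourhood of `f x`, composed with `f`, is a second system of representatives
  -- to compare with `φ`.
  have h2 : ∀ᶠ y in 𝓝 x, Represents s f (fun i y => η i (f y)) y := by
    filter_upwards [hf.continuousAt.eventually (hV.mem_nhds hg)] with y hy using hη.2 _ hy
  rw [← θ.sum_pullback_eq hφ (fun i => (hη' i).comp x hf) h h2]
  have h3 : ∀ i, FormField.pullback (I := I₁) (fun y => η i (f y)) θ.form.1 x = _ := fun i =>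
    FormField.pullback_comp θ.form.1 ((hη' i).mdifferentiableAt (by simp))
      (hf.mdifferentiableAt (by simp))
  refine Eq.trans ?_
    (Finset.sum_congr rfl fun i _ => congrArg (fun τ => (-1 : ℝ) ^ i.val • τ) (h3 i)).symm
  change ContinuousAlternatingMap.compContinuousLinearMap _ _ = _
  rw [h1]
  simp only [Fin.sum_univ_three]
  rfl

end CentralExtension
end Delta

/-! ### The total complex in low degrees. -/

section Cochains
variable {E H : Type*} [NormedAddCommGroup E] [NormedSpace ℝ E] [TopologicalSpace H]
  {I : ModelWithCorners ℝ E H} {G : Type*} [TopologicalSpace G] [ChartedSpace H G]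
  {F F' : Type*} [NormedAddCommGroup F] [NormedSpace ℝ F] [NormedAddCommGroup F'] [NormedSpace ℝ F']

theorem total_ext_three {a b : Total I G 3} (h0 : a ⟨(0, 3), rfl⟩ = b ⟨(0, 3), rfl⟩)
    (h1 : a ⟨(1, 2), rfl⟩ = b ⟨(1, 2), rfl⟩) (h2 : a ⟨(2, 1), rfl⟩ = b ⟨(2, 1), rfl⟩)
    (h3 : a ⟨(3, 0), rfl⟩ = b ⟨(3, 0), rfl⟩) : a = b := by
  funext ⟨⟨p, q⟩, h⟩
  have hp : p ≤ 3 := by simp only at h; omega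
  obtain rfl : q = 3 - p := by simp only at h; omega
  interval_cases p
  exacts [h0, h1, h2, h3]

variable [Group G] [LieGroup I ∞ G] [I.Boundaryless]

/-- A form on `G`, considered as a form on `NG(1)`. -/
def toNerve {q : ℕ} : DForm I G F q →ₗ[ℝ] DForm (nerveModel I 1) (Nerve G 1) F q :=
  DForm.pullback (fun g : Nerve G 1 => g 0) (contMDiff_eval (fun _ => I) 0)

/-- The alternating sum of the pull-backs along the face maps, for arbitrary coefficients. -/
def faceSum {p q : ℕ} : DForm (nerveModel I p) (Nerve G p) F q →ₗ[ℝ]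
    DForm (nerveModel I (p + 1)) (Nerve G (p + 1)) F q :=
  ∑ i : Fin (p + 2), (-1 : ℝ) ^ i.val • DForm.pullback (face i) (contMDiff_face I i)

theorem faceSum_eq_dHor {p q : ℕ} : faceSum (I := I) (G := G) (F := ℝ) (p := p) (q := q) = dHor I :=
  rfl

theorem faceSum_apply {p q : ℕ} (α : DForm (nerveModel I p) (Nerve G p) F q) :
    faceSum α = ∑ i : Fin (p + 2),
      (-1 : ℝ) ^ i.val • DForm.pullback (face i) (contMDiff_face I i) α := by
  simp only [faceSum, LinearMap.sum_apply, LinearMap.smul_apply]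

theorem faceSum_val {p q : ℕ} (α : DForm (nerveModel I p) (Nerve G p) F q) (g : Nerve G (p + 1)) :
    (faceSum α).1 g = ∑ i : Fin (p + 2),
      (-1 : ℝ) ^ i.val • FormField.pullback (I := nerveModel I (p + 1)) (face i) α.1 g := by
  rw [faceSum_apply, Submodule.coe_sum, Finset.sum_apply]
  rfl

theorem d_faceSum {p q : ℕ} (α : DForm (nerveModel I p) (Nerve G p) F q) :
    DForm.d (faceSum α) = faceSum (DForm.d α) := by
  simp only [faceSum_apply, map_sum, map_smul, DForm.d_pullback]

theorem faceSum_mapCoeff {p q : ℕ} (L : F →L[ℝ] F')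
    (α : DForm (nerveModel I p) (Nerve G p) F q) :
    faceSum (DForm.mapCoeff L α) = DForm.mapCoeff L (faceSum α) := by
  simp only [faceSum_apply, map_sum, map_smul, DForm.pullback_mapCoeff]

theorem faceSum_toNerve_val {q : ℕ} (c : DForm I G F q) (g : Nerve G 2) :
    (faceSum (toNerve c)).1 g = ∑ i : Fin 3, (-1 : ℝ) ^ i.val •
      FormField.pullback (I := nerveModel I 2) (fun g => face (p := 1) i g 0) c.1 g := by
  rw [faceSum_val]
  refine Finset.sum_congr rfl fun i _ => congrArg (fun τ => (-1 : ℝ) ^ i.val • τ) ?_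
  exact (FormField.pullback_comp c.1
    ((contMDiff_eval (fun _ : Fin 1 => I) 0).mdifferentiable (by simp) _)
    ((contMDiff_face I i).mdifferentiable (by simp) _)).symm

/-- The twelve composites of faces from `NG(3)` to `NG(1)` cancel in pairs by the six simplicial
identities. -/
theorem faceSum_faceSum_toNerve {q : ℕ} (c : DForm I G F q) :
    faceSum (faceSum (toNerve c)) = 0 := by
  refine Subtype.ext <| funext fun g => ?_
  let X : (Nerve G 3 → Nerve G 1) → TangentSpace (nerveModel I 3) g [⋀^Fin q]→L[ℝ] F :=
    fun f => FormField.pullback (I := nerveModel I 3) f (toNerve c).1 g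
  have e : ∀ j : Fin 4, FormField.pullback (I := nerveModel I 3) (face j)
      (faceSum (toNerve c)).1 g = X (fun g => face 0 (face j g)) - X (fun g => face 1 (face j g)) +
        X (fun g => face 2 (face j g)) := by
    intro j
    have hX : ∀ i : Fin 3, X (fun g => face i (face j g)) = FormField.pullback
        (I := nerveModel I 3) (face j) (FormField.pullback (I := nerveModel I 2) (face i)
          (toNerve c).1) g := fun i =>
      FormField.pullback_comp (toNerve c).1 ((contMDiff_face I i).mdifferentiable (by simp) _)
        ((contMDiff_face I j).mdifferentiable (by simp) _)
    have h3 : (faceSum (toNerve c)).1 (face j g) =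
        (FormField.pullback (I := nerveModel I 2) (face 0) (toNerve c).1 -
        FormField.pullback (I := nerveModel I 2) (face 1) (toNerve c).1 +
        FormField.pullback (I := nerveModel I 2) (face 2) (toNerve c).1) (face j g) := by
      rw [faceSum_val, Fin.sum_univ_three]
      simp only [Fin.val_zero, Fin.val_one, Fin.val_two, pow_zero, pow_one, one_smul, neg_smul,
        neg_one_sq, Pi.add_apply, sub_eq_add_neg, Pi.neg_apply]
    rw [hX, hX, hX, FormField.pullback_eq_of_eq h3]
    rfl
  have h01 : (fun g : Nerve G 3 => face (p := 1) 0 (face 1 g)) = fun g => face 0 (face 0 g) := by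
    funext g k; fin_cases k; rfl
  have h02 : (fun g : Nerve G 3 => face (p := 1) 0 (face 2 g)) = fun g => face 1 (face 0 g) := by
    funext g k; fin_cases k; rfl
  have h03 : (fun g : Nerve G 3 => face (p := 1) 0 (face 3 g)) = fun g => face 2 (face 0 g) := by
    funext g k; fin_cases k; rfl
  -- Only this identity uses associativity in `G`.
  have h12 : (fun g : Nerve G 3 => face (p := 1) 1 (face 2 g)) = fun g => face 1 (face 1 g) := by
    funext g k; fin_cases k; exact (mul_assoc (g 0) (g 1) (g 2)).symm
  have h13 : (fun g : Nerve G 3 => face (p := 1) 1 (face 3 g)) = fun g => face 2 (face 1 g) := by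
    funext g k; fin_cases k; rfl
  have h23 : (fun g : Nerve G 3 => face (p := 1) 2 (face 3 g)) = fun g => face 2 (face 2 g) := by
    funext g k; fin_cases k; rfl
  rw [faceSum_val, Fin.sum_univ_four, e, e, e, e, h01, h02, h03, h12, h13, h23]
  simp only [show ((0 : Fin 4).val) = 0 from rfl, show ((1 : Fin 4).val) = 1 from rfl,
    show ((2 : Fin 4).val) = 2 from rfl, show ((3 : Fin 4).val) = 3 from rfl]
  change _ = (0 : TangentSpace (nerveModel I 3) g [⋀^Fin q]→L[ℝ] F)
  module

/-- The cochain of degree 2 given by a one-form on `G`. -/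
def oneCochain (c : DForm I G ℝ 1) : Total I G 2
  | ⟨(1, 1), _⟩ => toNerve c
  | _ => 0

theorem d_toNerve {q : ℕ} (c : DForm I G F q) : DForm.d (toNerve c) = toNerve (DForm.d c) :=
  DForm.d_pullback _ _

theorem dVer_one {q : ℕ} (x : NerveForm I G 1 q) : dVer I x = -DForm.d x := by
  change (-1 : ℝ) ^ 1 • DForm.d x = _
  rw [pow_one]
  exact neg_one_smul ℝ (DForm.d x)

theorem dVer_two {q : ℕ} (x : NerveForm I G 2 q) : dVer I x = DForm.d x := by
  change (-1 : ℝ) ^ 2 • DForm.d x = _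
  rw [neg_one_sq, one_smul]

/-- This and the next lemma remove the term of a component of `totalD` that comes from a vanishing
neighbour. -/
theorem dHor_add_eq_right {p q : ℕ} {x : NerveForm I G p q} (y : NerveForm I G (p + 1) q)
    (hx : x = 0) : dHor I x + y = y := by
  rw [hx, map_zero, zero_add]

theorem add_dVer_eq_left {p q : ℕ} (x : NerveForm I G p (q + 1)) {y : NerveForm I G p q}
    (hy : y = 0) : x + dVer I y = x := by
  rw [hy, map_zero, add_zero]

theorem dVer_faceSum_toNerve {q : ℕ} (c : DForm I G ℝ q) :
    dVer I (faceSum (toNerve c)) = faceSum (toNerve (DForm.d c)) :=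
  (dVer_two _).trans ((d_faceSum _).trans (congrArg faceSum (d_toNerve c)))

theorem dHor_neg_add_eq_zero {p q : ℕ} (x : NerveForm I G p q) {y : NerveForm I G (p + 1) q}
    (h : y = faceSum x) : dHor I (-x) + y = 0 := by
  rw [h, map_neg, faceSum_eq_dHor, neg_add_cancel]

/-- The cocycle condition for cochains with components in bidegrees `(1, 2)` and `(2, 1)`. -/
theorem mem_cocycles_three {a : Total I G 3} (h0 : a ⟨(0, 3), rfl⟩ = 0)
    (h3 : a ⟨(3, 0), rfl⟩ = 0) (h13 : dVer I (a ⟨(1, 2), rfl⟩) = 0)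
    (h22 : dHor I (a ⟨(1, 2), rfl⟩) + dVer I (a ⟨(2, 1), rfl⟩) = 0)
    (h31 : dHor I (a ⟨(2, 1), rfl⟩) = 0) : a ∈ cocycles I G 3 := by
  refine LinearMap.mem_ker.2 ?_
  funext ⟨⟨p, q⟩, h⟩
  have hp : p ≤ 4 := by simp only at h; omega
  obtain rfl : q = 4 - p := by simp only at h; omega
  -- The five goals are the bidegrees `(0, 4)` to `(4, 0)`. The outer two involve only components
  -- assumed to be zero.
  interval_cases p
  · exact (congrArg (dVer I) h0).trans (map_zero _)
  · exact (dHor_add_eq_right _ h0).trans h13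
  · exact h22
  · exact (add_dVer_eq_left _ h3).trans h31
  · exact (congrArg (dHor I) h3).trans (map_zero _)

theorem totalD_oneCochain_zero_three (c : DForm I G ℝ 1) :
    totalD I G 2 (oneCochain c) ⟨(0, 3), rfl⟩ = 0 := map_zero (dVer I)

theorem totalD_oneCochain_three_zero (c : DForm I G ℝ 1) :
    totalD I G 2 (oneCochain c) ⟨(3, 0), rfl⟩ = 0 := map_zero (dHor I)

/-- The sign is `(-1)^p` at `p = 1`. -/
theorem totalD_oneCochain_one_two (c : DForm I G ℝ 1) :
    totalD I G 2 (oneCochain c) ⟨(1, 2), rfl⟩ = -toNerve (DForm.d c) :=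
  (dHor_add_eq_right (p := 0) (q := 2) _ rfl).trans
    ((dVer_one (toNerve c)).trans (congrArg Neg.neg (d_toNerve c)))

theorem totalD_oneCochain_two_one (c : DForm I G ℝ 1) :
    totalD I G 2 (oneCochain c) ⟨(2, 1), rfl⟩ = faceSum (toNerve c) :=
  add_dVer_eq_left (p := 2) (q := 0) _ rfl

/-- This is the only case of `D² = 0` that is needed. Its three components are `d² = 0`, the
commutation of `d` with face maps, and the simplicial identities. -/
theorem totalD_oneCochain_mem_cocycles (c : DForm I G ℝ 1) :
    totalD I G 2 (oneCochain c) ∈ cocycles I G 3 := by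
  refine mem_cocycles_three (totalD_oneCochain_zero_three c) (totalD_oneCochain_three_zero c)
    ?_ ?_ ?_
  · rw [totalD_oneCochain_one_two, dVer_one, map_neg, d_toNerve, DForm.d_d, map_zero, neg_zero,
      neg_zero]
  · rw [totalD_oneCochain_one_two, totalD_oneCochain_two_one]
    exact dHor_neg_add_eq_zero _ (dVer_faceSum_toNerve c)
  · rw [totalD_oneCochain_two_one]
    exact faceSum_faceSum_toNerve c

/-! ### The cochain of a connection: cocycle condition and change of connection. -/

variable {E' H' : Type*} [NormedAddCommGroup E'] [NormedSpace ℝ E'] [TopologicalSpace H']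
  {J : ModelWithCorners ℝ E' H'} {Gh : Type*} [TopologicalSpace Gh] [ChartedSpace H' Gh] [Group Gh]
  [LieGroup J ∞ Gh] [J.Boundaryless]

namespace CentralExtension
variable {C : CentralExtension I G J Gh}

/-- A lift satisfies `ρ ∘ ηᵢ = εᵢ`, so forms that come from `G` forget the lift and see only the
faces. -/
theorem IsLift.pullback_pullback_ρ {s : ∀ g, C.DeltaFiber g} {V : Set (Nerve G 2)}
    {η : Fin 3 → Nerve G 2 → Gh} (hη : C.IsLift s V η) (hV : IsOpen V) {g : Nerve G 2}
    (hg : g ∈ V) {q : ℕ} (c : DForm I G F q) (i : Fin 3) :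
    FormField.pullback (I := nerveModel I 2) (η i) (DForm.pullback C.ρ C.contMDiff_ρ c).1 g =
      FormField.pullback (I := nerveModel I 2) (fun g => face (p := 1) i g 0) c.1 g := by
  have h1 : ContMDiffAt (nerveModel I 2) J ∞ (η i) g := (hη.1 i).contMDiffAt (hV.mem_nhds hg)
  refine (FormField.pullback_comp c.1 (C.contMDiff_ρ.mdifferentiable (by simp) _)
    (h1.mdifferentiableAt (by simp))).symm.trans (FormField.pullback_congr c.1 ?_)
  filter_upwards [hV.mem_nhds hg] with y hy
  exact (hη.2 y hy).1 i

/-- The curvature of the induced connection on `δĜ`. -/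
theorem d_deltaPullback (θ : C.Connection) {s : ∀ g, C.DeltaFiber g} (hs : C.IsSmoothSection s)
    {c : DForm I G ℂ 2} (hc : DForm.pullback C.ρ C.contMDiff_ρ c = DForm.d θ.form) :
    DForm.d (deltaPullback θ s) = faceSum (toNerve c) := by
  refine Subtype.ext <| funext fun g => ?_
  obtain ⟨V, hV, hg, η, hη⟩ := hs g
  have hη' : ∀ i, ContMDiffAt (nerveModel I 2) J ∞ (η i) g := fun i =>
    (hη.1 i).contMDiffAt (hV.mem_nhds hg)
  have hsm : ∀ i : Fin 3, FormField.SmoothAt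
      (FormField.pullback (I := nerveModel I 2) (η i) θ.form.1) g := fun i =>
    FormField.contDiffAt_pullback θ.form.2 (hη' i)
  have h1 : ∀ᶠ y in 𝓝 g, (deltaPullback θ s).1 y = (∑ i : Fin 3, (-1 : ℝ) ^ i.val •
      FormField.pullback (I := nerveModel I 2) (η i) θ.form.1) y := by
    filter_upwards [hV.mem_nhds hg] with y hy
    rw [isDeltaPullback_deltaPullback θ hs V η hV hη y hy, Finset.sum_apply]
    rfl
  rw [faceSum_toNerve_val]
  refine (FormField.extDeriv_congr h1).trans ?_
  rw [FormField.extDeriv_sum fun i _ => (hsm i).smul _]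
  refine Finset.sum_congr rfl fun i _ => ?_
  rw [FormField.extDeriv_smul, FormField.extDeriv_pullback θ.form.2 (hη' i),
    ← hη.pullback_pullback_ρ hV hg, hc]
  rfl

/-- The dependence of `s^*(δθ)` on the connection. -/
theorem deltaPullback_sub (θ θ' : C.Connection) {s : ∀ g, C.DeltaFiber g}
    (hs : C.IsSmoothSection s) {γ : DForm I G ℂ 1}
    (hγ : DForm.pullback C.ρ C.contMDiff_ρ γ = θ'.form - θ.form) :
    deltaPullback θ' s - deltaPullback θ s = faceSum (toNerve γ) := by
  refine Subtype.ext <| funext fun g => ?_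
  obtain ⟨V, hV, hg, η, hη⟩ := hs g
  rw [faceSum_toNerve_val]
  change (deltaPullback θ' s).1 g - (deltaPullback θ s).1 g = _
  rw [isDeltaPullback_deltaPullback θ hs V η hV hη g hg,
    isDeltaPullback_deltaPullback θ' hs V η hV hη g hg, ← Finset.sum_sub_distrib]
  refine Finset.sum_congr rfl fun i _ => ?_
  rw [← smul_sub, ← hη.pullback_pullback_ρ hV hg, hγ]
  rfl

/-- The multiplication of `Ĝ` is associative, so the canonical section is parallel along the
tetrahedra of the nerve. -/
theorem faceSum_deltaPullback_canonicalSection (θ : C.Connection) :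
    faceSum (deltaPullback θ C.canonicalSection) = 0 := by
  refine Subtype.ext <| funext fun g => ?_
  choose V hV hgV σ hσ hs using fun i : Fin 3 => C.exists_local_section (g i)
  have he : ∀ i : Fin 3, ContMDiff (nerveModel I 3) I ∞ fun g : Nerve G 3 => g i := fun i =>
    contMDiff_eval (fun _ : Fin 3 => I) i
  let a : Fin 3 → Nerve G 3 → Gh := fun i g => σ i (g i)
  have ha : ∀ i, ContMDiffAt (nerveModel I 3) J ∞ (a i) g := fun i =>
    ((hσ i).contMDiffAt ((hV i).mem_nhds (hgV i))).comp (f := fun g : Nerve G 3 => g i) g (he i g)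
  have hρ : ∀ i, ∀ᶠ y in 𝓝 g, C.ρ (a i y) = y i := fun i => by
    filter_upwards [((hV i).preimage (he i).continuous).mem_nhds (hgV i)] with y hy using hs i _ hy
  have key : ∀ (j : Fin 4) {b b' : Nerve G 3 → Gh}, ContMDiffAt (nerveModel I 3) J ∞ b g →
      ContMDiffAt (nerveModel I 3) J ∞ b' g → (∀ᶠ y in 𝓝 g, C.ρ (b y) = face j y 0) →
      (∀ᶠ y in 𝓝 g, C.ρ (b' y) = face j y 1) →
      FormField.pullback (I := nerveModel I 3) (face j) (deltaPullback θ C.canonicalSection).1 g =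
        FormField.pullback (I := nerveModel I 3) b' θ.form.1 g -
        FormField.pullback (I := nerveModel I 3) (fun y => b y * b' y) θ.form.1 g +
        FormField.pullback (I := nerveModel I 3) b θ.form.1 g := by
    intro j b b' hb hb' h h'
    rw [pullback_deltaPullback θ isSmoothSection_canonicalSection (contMDiff_face I j g)
      (φ := ![b', fun y => b y * b' y, b]) ?_ ?_]
    · simp only [Fin.sum_univ_three, Fin.val_zero, Fin.val_one, Fin.val_two, pow_zero, pow_one,
        one_smul, neg_smul, neg_one_sq, sub_eq_add_neg]
      rfl
    · intro i
      fin_cases i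
      exacts [hb', hb.mul hb', hb]
    · filter_upwards [h, h'] with y hy hy' using canonicalSection_represents hy hy'
  have hρ2 : ∀ i j, ∀ᶠ y in 𝓝 g, C.ρ (a i y * a j y) = y i * y j := fun i j => by
    filter_upwards [hρ i, hρ j] with y hy hy'
    rw [map_mul, hy, hy']
  -- All four faces are lifted by products of the same `a 0`, `a 1`, `a 2`. The form then depends on
  -- only six maps, each occurring twice.
  have k0 := key 0 (ha 1) (ha 2) (hρ 1) (hρ 2)
  have k1 := key 1 ((ha 0).mul (ha 1)) (ha 2) (hρ2 0 1) (hρ 2)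
  have k2 := key 2 (ha 0) ((ha 1).mul (ha 2)) (hρ 0) (hρ2 1 2)
  have k3 := key 3 (ha 0) (ha 1) (hρ 0) (hρ 1)
  -- The triple products from faces 1 and 2 agree, so their terms cancel. The remaining terms cancel
  -- formally.
  have hassoc : (fun y => (a 0 * a 1) y * a 2 y) = fun y => a 0 y * (a 1 * a 2) y :=
    funext fun y => mul_assoc _ _ _
  rw [hassoc] at k1
  rw [faceSum_val, Fin.sum_univ_four, k0, k1, k2, k3]
  simp only [show ((0 : Fin 4).val) = 0 from rfl, show ((1 : Fin 4).val) = 1 from rfl,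
    show ((2 : Fin 4).val) = 2 from rfl, show ((3 : Fin 4).val) = 3 from rfl]
  change _ = (0 : TangentSpace (nerveModel I 3) g [⋀^Fin 1]→L[ℝ] ℂ)
  have e1 : (fun y => a 0 y * a 1 y) = a 0 * a 1 := rfl
  have e2 : (fun y => a 1 y * a 2 y) = a 1 * a 2 := rfl
  rw [e1, e2]
  module

/-- The complex form is kept next to `c₁(θ)` because `d_deltaPullback` is a statement before
normalization. -/
theorem exists_curvature (θ : C.Connection) : ∃ c : DForm I G ℂ 2,
    DForm.pullback C.ρ C.contMDiff_ρ c = DForm.d θ.form ∧ chernForm θ = normalize c := by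
  obtain ⟨c, hc⟩ := exists_pullback_ρ_eq_d θ
  refine ⟨c, hc, pullback_ρ_injective (C := C) ((isChernForm_chernForm θ).trans ?_)⟩
  rw [← hc]
  rfl

/-- The components of the condition are closedness of the curvature, `d_deltaPullback`, and
associativity in the form of `faceSum_deltaPullback_canonicalSection`. -/
theorem ddCochain_mem_cocycles (θ : C.Connection) :
    ddCochain θ C.canonicalSection ∈ cocycles I G 3 := by
  obtain ⟨c, hc, hθ⟩ := exists_curvature θ
  -- Closedness is checked on `Ĝ`, where the curvature is exact.
  have hdc : DForm.d c = 0 := by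
    refine pullback_ρ_injective (C := C) ?_
    rw [← DForm.d_pullback, hc, DForm.d_d, map_zero]
  refine mem_cocycles_three rfl rfl ?_ ?_ ?_
  · change dVer I (toNerve (chernForm θ)) = 0
    rw [dVer_one, neg_eq_zero, d_toNerve, hθ, normalize, DForm.d_mapCoeff, hdc, map_zero, map_zero]
  · change dHor I (toNerve (chernForm θ)) +
      dVer I (-normalize (deltaPullback θ C.canonicalSection)) = 0
    rw [dVer_two, ← faceSum_eq_dHor, map_neg, normalize, DForm.d_mapCoeff, d_deltaPullback θ isSmoothSection_canonicalSection hc,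
      hθ, ← faceSum_mapCoeff, add_neg_eq_zero]
    rfl
  · change dHor I (-normalize (deltaPullback θ C.canonicalSection)) = 0
    rw [← faceSum_eq_dHor, map_neg, normalize, faceSum_mapCoeff, faceSum_deltaPullback_canonicalSection, map_zero,
      neg_zero]

/-- The cochains of two connections differ by the coboundary of the difference of the connections. -/
theorem exists_ddCochain_sub_eq (θ θ' : C.Connection) {s : ∀ g, C.DeltaFiber g}
    (hs : C.IsSmoothSection s) :
    ∃ c : DForm I G ℝ 1, ddCochain θ' s - ddCochain θ s = totalD I G 2 (oneCochain c) := by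
  obtain ⟨γ, hγ⟩ := exists_pullback_ρ_eq_sub θ θ'
  -- The sign makes `d'' = -d` on `NG(1)` produce `+dγ`, and it matches the minus sign before
  -- `s^*(δθ)` in bidegree `(2, 1)`.
  refine ⟨-normalize γ, total_ext_three ?_ ?_ ?_ ?_⟩
  · rw [totalD_oneCochain_zero_three]
    exact sub_zero _
  · rw [totalD_oneCochain_one_two]
    change toNerve (chernForm θ') - toNerve (chernForm θ) = _
    rw [← map_sub, map_neg, map_neg, neg_neg]
    congr 1
    refine pullback_ρ_injective (C := C) ?_
    have h : ∀ θ : C.Connection, DForm.pullback C.ρ C.contMDiff_ρ (chernForm θ) =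
      normalize (DForm.d θ.form) := isChernForm_chernForm
    rw [map_sub, h, h, ← map_sub, ← map_sub, ← hγ, ← DForm.d_pullback]
    exact (DForm.d_mapCoeff _ _).symm
  · rw [totalD_oneCochain_two_one]
    change -normalize (deltaPullback θ' s) - -normalize (deltaPullback θ s) = _
    rw [map_neg, map_neg, ← neg_sub_neg, neg_neg, neg_neg, ← neg_sub, ← map_sub,
      deltaPullback_sub θ θ' hs hγ, normalize, ← faceSum_mapCoeff]
    rfl
  · rw [totalD_oneCochain_three_zero]
    exact sub_zero _

end CentralExtension
end Cochains

end SimplicialDeRham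

end

theorem proposition2p3
    {E H G : Type*} [NormedAddCommGroup E] [NormedSpace ℝ E] [TopologicalSpace H]
    (I : ModelWithCorners ℝ E H) [I.Boundaryless]
    [TopologicalSpace G] [ChartedSpace H G] [Group G] [LieGroup I ∞ G]
    {E' H' Gh : Type*} [NormedAddCommGroup E'] [NormedSpace ℝ E'] [TopologicalSpace H']
    (J : ModelWithCorners ℝ E' H') [J.Boundaryless]
    [TopologicalSpace Gh] [ChartedSpace H' Gh] [Group Gh] [LieGroup J ∞ Gh]
    (C : SimplicialDeRham.CentralExtension I G J Gh) :
    -- the forms `c₁(θ)` and `s^*(δθ)` are well defined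
    (∀ θ : C.Connection, ∃! c, SimplicialDeRham.CentralExtension.IsChernForm θ c) ∧
    (∀ (θ : C.Connection) (s : ∀ g, C.DeltaFiber g), C.IsSmoothSection s →
      ∃! β, SimplicialDeRham.CentralExtension.IsDeltaPullback θ s β) ∧
    -- for the canonical section the cochain is a cocycle
    C.IsSmoothSection C.canonicalSection ∧
    (∀ θ : C.Connection, SimplicialDeRham.CentralExtension.ddCochain θ C.canonicalSection ∈
      SimplicialDeRham.cocycles I G 3) ∧
    -- for every section, the cochains of two connections differ by a coboundary; so if one of them
    -- is a cocycle, then so is the other, and their classes in `H^3(Ω(NG))` agree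
    ∀ s : ∀ g, C.DeltaFiber g, C.IsSmoothSection s → ∀ θ₀ θ₁ : C.Connection,
      SimplicialDeRham.CentralExtension.ddCochain θ₁ s -
          SimplicialDeRham.CentralExtension.ddCochain θ₀ s ∈
        SimplicialDeRham.coboundaries I G 3 ∧
      ∀ h₀ : SimplicialDeRham.CentralExtension.ddCochain θ₀ s ∈ SimplicialDeRham.cocycles I G 3,
        ∃ h₁ : SimplicialDeRham.CentralExtension.ddCochain θ₁ s ∈ SimplicialDeRham.cocycles I G 3,
          SimplicialDeRham.cohomologyClass I (SimplicialDeRham.CentralExtension.ddCochain θ₀ s) h₀ =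
          SimplicialDeRham.cohomologyClass I
            (SimplicialDeRham.CentralExtension.ddCochain θ₁ s) h₁ := by
  open SimplicialDeRham SimplicialDeRham.CentralExtension in
  refine ⟨existsUnique_isChernForm, fun θ _ => existsUnique_isDeltaPullback θ,
    isSmoothSection_canonicalSection, ddCochain_mem_cocycles, fun s hs θ₀ θ₁ => ?_⟩
  obtain ⟨c, hc⟩ := SimplicialDeRham.CentralExtension.exists_ddCochain_sub_eq θ₀ θ₁ hs
  have hb : SimplicialDeRham.CentralExtension.ddCochain θ₁ s -
      SimplicialDeRham.CentralExtension.ddCochain θ₀ s ∈ SimplicialDeRham.coboundaries I G 3 :=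
    ⟨SimplicialDeRham.oneCochain c, hc.symm⟩
  refine ⟨hb, fun h₀ => ?_⟩
  -- The cochain of `θ₁` is that of `θ₀` plus a coboundary of `oneCochain` type, which is a cocycle.
  have h₁ : SimplicialDeRham.CentralExtension.ddCochain θ₁ s ∈ SimplicialDeRham.cocycles I G 3 := by
    have h := (SimplicialDeRham.cocycles I G 3).add_mem
      (hc ▸ SimplicialDeRham.totalD_oneCochain_mem_cocycles c) h₀
    rwa [sub_add_cancel] at h
  refine ⟨h₁, Eq.symm ?_⟩
  unfold SimplicialDeRham.cohomologyClass
  exact (Submodule.Quotient.eq _).2 hb
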